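/- **Setting.** A base station with $M$ antennas uses a beamformer $\mathbf w\in\mathbb C^M$; a radar with $N$ antennas uses a waveform covariance $\mathbf Q\succeq 0$. With channels $\mathbf h_{\rm rw}\in\mathbb C^N$, $\mathbf h_{\rm aw}\in\mathbb C^M$ to an adversary with noise power $\sigma_w^2>0$, put $\lambda_0=\mathbf h_{\rm rw}^H\mathbf Q\mathbf h_{\rm rw}+\sigma_w^2$ and $\lambda_1=\mathbf h_{\rm rw}^H\mathbf Q\mathbf h_{\rm rw}+|\mathbf h_{\rm aw}^H\mathbf w|^2+\sigma_w^2$, and let $p_i(y)=\frac1{\pi\lambda_i}e^{-|y|^2/\lambda_i}$ on $\mathbb C$ (the law $\mathcal{CN}(0,\lambda_i)$). $D(p_0\|p_1)$ is the Kullback–Leibler divergence. Let $\varepsilon>0$ and $f(x)=\ln x+\frac1x-1-2\varepsilon^2$ for $x>0$. The channels are $\mathbf h_{\rm aw}=\hat{\mathbf h}_{\rm aw}+\Delta\mathbf h_{\rm aw}$ and $\mathbf h_{\rm rw}=\hat{\mathbf h}_{\rm rw}+\Delta\mathbf h_{\rm rw}$, with known $\hat{\mathbf h}_{\rm aw},\hat{\mathbf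 h}_{\rm rw}$ and errors in the ellipsoids $$\mathcal E_{\rm aw}=\Big\{\Delta:\frac{\Delta^H\mathbf C_{\rm aw}\Delta}{\kappa_{\rm aw}}\le o_{\rm aw}^2\Big\},\qquad \mathcal E_{\rm rw}=\Big\{\Delta:\frac{\Delta^H\mathbf C_{\rm rw}\Delta}{\kappa_{\rm rw}}\le o_{\rm rw}^2\Big\},$$ where $\mathbf C_{\rm aw},\mathbf C_{\rm rw}\succeq0$, $o_{\rm aw},o_{\rm rw}>0$ and $\kappa_{\rm aw},\kappa_{\rm rw}>0$ are normalizing constants ($\kappa=\|\hat{\mathbf h}\|_2^2$ for errors relative to the predicted channel $\hat{\mathbf h}\ne 0$, $\kappa=1$ for absolute errors). **Claim 1.** $f$ is strictly decreasing on $(0,1]$, strictly increasing on $[1,\infty)$, and has exactly two positive roots $x_1<1<x_2$. For all $\lambda_0,\lambda_1>0$, $D(p_0\|p_1)\le2\varepsilon^2$ if and only if $x_1\le\lambda_1/\lambda_0\le x_2$. For $\lambda_0,\lambda_1$ given by $\mathbf Q\succeq0$, $\mathbf w$ and the channels as above, $\lambda_1\ge\lambda_0>0$, so the constraint is equivalent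 to $\lambda_1/\lambda_0\le x_2$. **Claim 2.** Put $\tilde{\mathbf Q}=(x_2-1)\mathbf Q$, $q_1=(x_2-1)\sigma_w^2$ and $q_2=\hat{\mathbf h}_{\rm rw}^H\tilde{\mathbf Q}\hat{\mathbf h}_{\rm rw}+q_1-\mu_1\kappa_{\rm rw}o_{\rm rw}^2$. For all $\mathbf Q\succeq0$ and $\mathbf W\succeq0$ the following are equivalent, where $\mathbf h_{\rm aw}=\hat{\mathbf h}_{\rm aw}+\Delta\mathbf h_{\rm aw}$, $\mathbf h_{\rm rw}=\hat{\mathbf h}_{\rm rw}+\Delta\mathbf h_{\rm rw}$: (a) $\dfrac{\mathbf h_{\rm rw}^H\mathbf Q\mathbf h_{\rm rw}+\mathbf h_{\rm aw}^H\mathbf W\mathbf h_{\rm aw}+\sigma_w^2}{\mathbf h_{\rm rw}^H\mathbf Q\mathbf h_{\rm rw}+\sigma_w^2}\le x_2$ for all $\Delta\mathbf h_{\rm aw}\in\mathcal E_{\rm aw}$, $\Delta\mathbf h_{\rm rw}\in\mathcal E_{\rm rw}$; (b) $\mathbf h_{\rm rw}^H\tilde{\mathbf Q}\mathbf h_{\rm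 rw}-\mathbf h_{\rm aw}^H\mathbf W\mathbf h_{\rm aw}+q_1\ge0$ for all such errors; (c) $\Delta\mathbf h_{\rm rw}^H\tilde{\mathbf Q}\Delta\mathbf h_{\rm rw}+2\,\mathrm{Re}\{\hat{\mathbf h}_{\rm rw}^H\tilde{\mathbf Q}\Delta\mathbf h_{\rm rw}\}+\hat{\mathbf h}_{\rm rw}^H\tilde{\mathbf Q}\hat{\mathbf h}_{\rm rw}-\mathbf h_{\rm aw}^H\mathbf W\mathbf h_{\rm aw}+q_1\ge0$ for all such errors; (d) (QMI) there is $\mu_1\ge0$ such that for all $\Delta\mathbf h_{\rm aw}\in\mathcal E_{\rm aw}$ $$\begin{bmatrix}\mu_1\mathbf C_{\rm rw}+\tilde{\mathbf Q}&\tilde{\mathbf Q}^H\hat{\mathbf h}_{\rm rw}\\ \hat{\mathbf h}_{\rm rw}^H\tilde{\mathbf Q}&q_2-\mathbf h_{\rm aw}^H\mathbf W\mathbf h_{\rm aw}\end{bmatrix}\succeq0;$$ (e) (LMI) there are $\mu_1,\mu_2\ge0$ such that $$\begin{bmatrix}\mu_1\mathbf C_{\rm rw}+\tilde{\mathbf Q}&\tilde{\mathbf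 Q}^H\hat{\mathbf h}_{\rm rw}&\mathbf 0\\ \hat{\mathbf h}_{\rm rw}^H\tilde{\mathbf Q}&q_2-\hat{\mathbf h}_{\rm aw}^H\mathbf W\hat{\mathbf h}_{\rm aw}-\mu_2&-\hat{\mathbf h}_{\rm aw}^H\mathbf W\\ \mathbf 0&-\mathbf W\hat{\mathbf h}_{\rm aw}&\frac{\mu_2}{\kappa_{\rm aw}o_{\rm aw}^2}\mathbf C_{\rm aw}-\mathbf W\end{bmatrix}\succeq0.$$ In particular, for every $\mathbf w\in\mathbb C^M$ and $\mathbf Q\succeq 0$, $D(p_0\|p_1)\le2\varepsilon^2$ holds for all errors in $\mathcal E_{\rm aw}\times\mathcal E_{\rm rw}$ if and only if (e) holds with $\mathbf W=\mathbf w\mathbf w^H$. **Claim 3.** Let $\mathbf h_{\rm ab}\in\mathbb C^M$, $\mathbf h_{\rm rb},\mathbf a_r\in\mathbb C^N$, $\mathbf H_{\rm ab}=\mathbf h_{\rm ab}\mathbf h_{\rm ab}^H$, $\mathbf H_{\rm rb}=\mathbf h_{\rm rb}\mathbf h_{\rm rb}^H$, $\sigma_b,P_A,P_R,\mathrm{MSE}_{\max}\in\mathbb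 R$, and let $\hat{\mathbf C}(\mathbf Q)^{-1}=\mathbf P^{-1}+\gamma_r(\mathbf Q)\,\mathbf G^T\boldsymbol\Lambda\mathbf G$ with $\gamma_r(\mathbf Q)=g\,\mathbf a_r^H\mathbf Q\mathbf a_r$, $g\ge0$, $\mathbf P\in\mathbb R^{6\times6}$ positive definite (prediction covariance), $\mathbf G\in\mathbb R^{5\times6}$ (measurement Jacobian) and $\boldsymbol\Lambda\in\mathbb R^{5\times5}$ positive semidefinite (measurement precision at unit $\gamma_r$). For every $l\in\mathbb R$ consider the Dinkelbach step: over Hermitian $\mathbf W,\mathbf Q$, maximize $\mathrm{tr}(\mathbf H_{\rm ab}\mathbf W)-l(\mathrm{tr}(\mathbf H_{\rm rb}\mathbf Q)+\sigma_b^2)$ subject to $\mathbf W\succeq0$, $\mathrm{tr}\,\mathbf W\le P_A$, $\mathbf Q\succeq0$, $\mathrm{tr}\,\mathbf Q\le P_R$, $\mathrm{tr}\,\hat{\mathbf C}(\mathbf Q)\le\mathrm{MSE}_{\max}$, and (b). Consider also the problem of maximizing the same objective over $(\mathbf W,\mathbf Q,t_1,\dots,t_6,\mu_1,\mu_2)$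 with the same semidefiniteness and trace constraints on $\mathbf W,\mathbf Q$, with $t_i,\mu_1,\mu_2\ge0$, $\begin{bmatrix}\hat{\mathbf C}(\mathbf Q)^{-1}&\mathbf e_i\\ \mathbf e_i^T&t_i\end{bmatrix}\succeq0$ for $i=1,\dots,6$, $\sum_it_i\le\mathrm{MSE}_{\max}$, and the matrix inequality in (e). The latter is a semidefinite program (affine objective, finitely many linear matrix inequalities); $(\mathbf W,\mathbf Q)$ is feasible for the step if and only if it extends to a feasible point of the semidefinite program, and it is a maximizer of the step if and only if it extends to a maximizer of the semidefinite program. -/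

import Mathlib

open Matrix
open scoped ComplexOrder

noncomputable section

/-- The function `f(x) = ln x + 1/x - 1 - 2 ε²` (used for `x > 0`). -/
def covertFun (ε x : ℝ) : ℝ := Real.log x + 1 / x - 1 - 2 * ε ^ 2

/-- The law `CN(0, v)` on `ℂ`, with density `exp (-|y|² / v) / (π v)` with respect to Lebesgue
measure (for `v > 0`). -/
def complexGaussian (v : ℝ) : MeasureTheory.Measure ℂ :=
  MeasureTheory.volume.withDensity fun y : ℂ =>
    ENNReal.ofReal (1 / (Real.pi * v) * Real.exp (-(‖y‖ ^ 2 / v)))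

/-- The quadratic form `xᴴ A x`, a real number when `A` is Hermitian. -/
def quadForm {n : ℕ} (A : Matrix (Fin n) (Fin n) ℂ) (x : Fin n → ℂ) : ℝ :=
  (star x ⬝ᵥ A *ᵥ x).re

/-- The uncertainty ellipsoid `{Δ | Δᴴ C Δ / κ ≤ o²}`. The normalization `κ` is `‖ĥ‖²` when the
error is measured relative to the predicted channel `ĥ`, and `1` when it is measured absolutely. -/
def ellipsoid {n : ℕ} (C : Matrix (Fin n) (Fin n) ℂ) (κ o : ℝ) : Set (Fin n → ℂ) :=
  {Δ | quadForm C Δ / κ ≤ o ^ 2}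

/-- The received power of the adversary when the base station is silent. -/
def powerH0 {N : ℕ} (Q : Matrix (Fin N) (Fin N) ℂ) (hrw : Fin N → ℂ) (σw : ℝ) : ℝ :=
  quadForm Q hrw + σw ^ 2

/-- The received power of the adversary when the base station transmits with beamformer `w`. -/
def powerH1 {M N : ℕ} (Q : Matrix (Fin N) (Fin N) ℂ) (w : Fin M → ℂ)
    (hrw : Fin N → ℂ) (haw : Fin M → ℂ) (σw : ℝ) : ℝ :=
  quadForm Q hrw + ‖star haw ⬝ᵥ w‖ ^ 2 + σw ^ 2

/-- The covertness constraint `D(p₀ ‖ p₁) ≤ 2 ε²` at the channels `hrw`, `haw`. -/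
def IsCovert {M N : ℕ} (ε : ℝ) (Q : Matrix (Fin N) (Fin N) ℂ) (w : Fin M → ℂ)
    (hrw : Fin N → ℂ) (haw : Fin M → ℂ) (σw : ℝ) : Prop :=
  InformationTheory.klDiv (complexGaussian (powerH0 Q hrw σw))
    (complexGaussian (powerH1 Q w hrw haw σw)) ≤ ENNReal.ofReal (2 * ε ^ 2)

/-- The data of the design problem: `M` antennas at the base station, `N` at the radar. -/
structure CovertSystem (M N : ℕ) where
  /-- predicted channel from the base station to the adversary -/
  haw : Fin M → ℂ
  /-- predicted channel from the radar to the adversary -/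
  hrw : Fin N → ℂ
  /-- channel from the base station to the user -/
  hab : Fin M → ℂ
  /-- channel from the radar to the user -/
  hrb : Fin N → ℂ
  /-- shape matrix of the uncertainty of the channel `haw` -/
  Caw : Matrix (Fin M) (Fin M) ℂ
  /-- shape matrix of the uncertainty of the channel `hrw` -/
  Crw : Matrix (Fin N) (Fin N) ℂ
  /-- normalization of the uncertainty of `haw` -/
  κaw : ℝ
  /-- normalization of the uncertainty of `hrw` -/
  κrw : ℝ
  /-- size of the uncertainty of `haw` -/
  oaw : ℝ
  /-- size of the uncertainty of `hrw` -/
  orw : ℝ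
  /-- noise standard deviation at the adversary -/
  σw : ℝ
  /-- noise standard deviation at the user -/
  σb : ℝ
  /-- power budget of the base station -/
  PA : ℝ
  /-- power budget of the radar -/
  PR : ℝ
  /-- radar response vector in the predicted direction of the adversary -/
  ar : Fin N → ℂ
  /-- echo gain: the echo signal-to-noise ratio is `gain * arᴴ Q ar` -/
  gain : ℝ
  /-- one-step prediction covariance of the state of the adversary -/
  Cpred : Matrix (Fin 6) (Fin 6) ℝ
  /-- Jacobian of the measurement map -/
  G : Matrix (Fin 5) (Fin 6) ℝ
  /-- inverse of the measurement covariance at unit echo signal-to-noise ratio -/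
  precision : Matrix (Fin 5) (Fin 5) ℝ
  /-- maximal tolerable tracking error -/
  MSEmax : ℝ

namespace CovertSystem

variable {M N : ℕ}

/-- The standing assumptions on the data. -/
structure Admissible (S : CovertSystem M N) : Prop where
  Caw_psd : S.Caw.PosSemidef
  Crw_psd : S.Crw.PosSemidef
  κaw_pos : 0 < S.κaw
  κrw_pos : 0 < S.κrw
  oaw_pos : 0 < S.oaw
  orw_pos : 0 < S.orw
  σw_pos : 0 < S.σw
  gain_nonneg : 0 ≤ S.gain
  Cpred_pd : S.Cpred.PosDef
  precision_psd : S.precision.PosSemidef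

/-- The uncertainty set of the error in `haw`. -/
def Eaw (S : CovertSystem M N) : Set (Fin M → ℂ) := ellipsoid S.Caw S.κaw S.oaw

/-- The uncertainty set of the error in `hrw`. -/
def Erw (S : CovertSystem M N) : Set (Fin N → ℂ) := ellipsoid S.Crw S.κrw S.orw

/-- `Q̃ = (x₂ - 1) Q`. -/
def Qt (x₂ : ℝ) (Q : Matrix (Fin N) (Fin N) ℂ) : Matrix (Fin N) (Fin N) ℂ := (x₂ - 1) • Q

/-- `q₁ = (x₂ - 1) σ_w²`. -/
def q1 (S : CovertSystem M N) (x₂ : ℝ) : ℝ := (x₂ - 1) * S.σw ^ 2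

/-- `q₂ = ĥ_rwᴴ Q̃ ĥ_rw + q₁ - μ₁ κ_rw o_rw²`. -/
def q2 (S : CovertSystem M N) (x₂ : ℝ) (Q : Matrix (Fin N) (Fin N) ℂ) (μ₁ : ℝ) : ℝ :=
  quadForm (Qt x₂ Q) S.hrw + S.q1 x₂ - μ₁ * (S.κrw * S.orw ^ 2)

/-- The relaxed covertness constraint on the power ratio, at the channel errors `Δaw`, `Δrw`. -/
def RatioConstraint (S : CovertSystem M N) (x₂ : ℝ) (W : Matrix (Fin M) (Fin M) ℂ)
    (Q : Matrix (Fin N) (Fin N) ℂ) (Δaw : Fin M → ℂ) (Δrw : Fin N → ℂ) : Prop :=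
  (quadForm Q (S.hrw + Δrw) + quadForm W (S.haw + Δaw) + S.σw ^ 2) /
    (quadForm Q (S.hrw + Δrw) + S.σw ^ 2) ≤ x₂

/-- The constraint on the power ratio, with the denominator cleared. -/
def QuadConstraint (S : CovertSystem M N) (x₂ : ℝ) (W : Matrix (Fin M) (Fin M) ℂ)
    (Q : Matrix (Fin N) (Fin N) ℂ) (Δaw : Fin M → ℂ) (Δrw : Fin N → ℂ) : Prop :=
  0 ≤ quadForm (Qt x₂ Q) (S.hrw + Δrw) - quadForm W (S.haw + Δaw) + S.q1 x₂

/-- The same constraint, expanded in `Δrw`. -/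
def WorstCaseConstraint (S : CovertSystem M N) (x₂ : ℝ) (W : Matrix (Fin M) (Fin M) ℂ)
    (Q : Matrix (Fin N) (Fin N) ℂ) (Δaw : Fin M → ℂ) (Δrw : Fin N → ℂ) : Prop :=
  0 ≤ quadForm (Qt x₂ Q) Δrw + 2 * (star S.hrw ⬝ᵥ Qt x₂ Q *ᵥ Δrw).re
    + quadForm (Qt x₂ Q) S.hrw - quadForm W (S.haw + Δaw) + S.q1 x₂

/-- The `(N+1) × (N+1)` block matrix
`[μ₁ C_rw + Q̃, Q̃ᴴ ĥ_rw; ĥ_rwᴴ Q̃, c]`. -/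
def cornerMatrix (S : CovertSystem M N) (x₂ : ℝ) (Q : Matrix (Fin N) (Fin N) ℂ) (μ₁ c : ℝ) :
    Matrix (Fin N ⊕ Unit) (Fin N ⊕ Unit) ℂ :=
  fromBlocks (μ₁ • S.Crw + Qt x₂ Q) (replicateCol Unit ((Qt x₂ Q)ᴴ *ᵥ S.hrw))
    (replicateRow Unit (star S.hrw ᵥ* Qt x₂ Q)) (of fun _ _ => (c : ℂ))

/-- The quadratic matrix inequality's matrix, at the channel error `Δaw`. -/
def qmiMatrix (S : CovertSystem M N) (x₂ : ℝ) (W : Matrix (Fin M) (Fin M) ℂ)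
    (Q : Matrix (Fin N) (Fin N) ℂ) (μ₁ : ℝ) (Δaw : Fin M → ℂ) :
    Matrix (Fin N ⊕ Unit) (Fin N ⊕ Unit) ℂ :=
  S.cornerMatrix x₂ Q μ₁ (S.q2 x₂ Q μ₁ - quadForm W (S.haw + Δaw))

/-- The linear matrix inequality's matrix
`[μ₁ C_rw + Q̃, Q̃ᴴ ĥ_rw, 0;`
` ĥ_rwᴴ Q̃, q₂ - ĥ_awᴴ W ĥ_aw - μ₂, -ĥ_awᴴ W;`
` 0, -W ĥ_aw, (μ₂ / (κ_aw o_aw²)) C_aw - W]`. -/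
def lmiMatrix (S : CovertSystem M N) (x₂ : ℝ) (W : Matrix (Fin M) (Fin M) ℂ)
    (Q : Matrix (Fin N) (Fin N) ℂ) (μ₁ μ₂ : ℝ) :
    Matrix ((Fin N ⊕ Unit) ⊕ Fin M) ((Fin N ⊕ Unit) ⊕ Fin M) ℂ :=
  fromBlocks (S.cornerMatrix x₂ Q μ₁ (S.q2 x₂ Q μ₁ - quadForm W S.haw - μ₂))
    (fromRows 0 (replicateRow Unit (-(star S.haw ᵥ* W))))
    (fromCols 0 (replicateCol Unit (-(W *ᵥ S.haw))))
    ((μ₂ / (S.κaw * S.oaw ^ 2)) • S.Caw - W)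

/-- The inverse posterior covariance `Ĉ⁻¹ = C_pred⁻¹ + γ_r Gᵀ R⁻¹ G` of the state of the adversary,
where `γ_r = gain * arᴴ Q ar` and `R⁻¹` is the measurement precision at unit `γ_r`. -/
def infoMatrix (S : CovertSystem M N) (Q : Matrix (Fin N) (Fin N) ℂ) :
    Matrix (Fin 6) (Fin 6) ℝ :=
  S.Cpred⁻¹ + (S.gain * quadForm Q S.ar) • (S.Gᵀ * S.precision * S.G)

/-- The matrix `[Ĉ⁻¹, eᵢ; eᵢᵀ, tᵢ]`. -/
def mseMatrix (S : CovertSystem M N) (Q : Matrix (Fin N) (Fin N) ℂ) (i : Fin 6) (ti : ℝ) :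
    Matrix (Fin 6 ⊕ Unit) (Fin 6 ⊕ Unit) ℝ :=
  fromBlocks (S.infoMatrix Q) (replicateCol Unit (Pi.single i 1))
    (replicateRow Unit (Pi.single i 1)) (of fun _ _ => ti)

/-- The Hermitian variables `(W, Q)` of a Dinkelbach step. -/
abbrev StepVar (M N : ℕ) : Type :=
  selfAdjoint (Matrix (Fin M) (Fin M) ℂ) × selfAdjoint (Matrix (Fin N) (Fin N) ℂ)

/-- The variables `((W, Q), t, μ₁, μ₂)` of the semidefinite program. -/
abbrev SDPVar (M N : ℕ) : Type := StepVar M N × (Fin 6 → ℝ) × ℝ × ℝ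

/-- Constraints common to both problems: `W ⪰ 0`, `tr W ≤ P_A`, `Q ⪰ 0`, `tr Q ≤ P_R`. -/
def PowerConstraints (S : CovertSystem M N) (v : StepVar M N) : Prop :=
  (v.1 : Matrix (Fin M) (Fin M) ℂ).PosSemidef ∧
    (trace (v.1 : Matrix (Fin M) (Fin M) ℂ)).re ≤ S.PA ∧
    (v.2 : Matrix (Fin N) (Fin N) ℂ).PosSemidef ∧
    (trace (v.2 : Matrix (Fin N) (Fin N) ℂ)).re ≤ S.PR

/-- The feasible set of a Dinkelbach step (rank constraint dropped), with the robust constraint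
imposed for all channel errors in the uncertainty sets. -/
def stepFeasible (S : CovertSystem M N) (x₂ : ℝ) : Set (StepVar M N) :=
  {v | S.PowerConstraints v ∧ trace (S.infoMatrix (v.2 : Matrix (Fin N) (Fin N) ℂ))⁻¹ ≤ S.MSEmax ∧
    ∀ Δaw ∈ S.Eaw, ∀ Δrw ∈ S.Erw, S.QuadConstraint x₂ v.1 v.2 Δaw Δrw}

/-- The objective `tr(H_ab W) - l (tr(H_rb Q) + σ_b²)` of the Dinkelbach step with parameter `l`,
where `H_ab = h_ab h_abᴴ` and `H_rb = h_rb h_rbᴴ`. -/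
def stepObjective (S : CovertSystem M N) (l : ℝ) (v : StepVar M N) : ℝ :=
  (trace (vecMulVec S.hab (star S.hab) * (v.1 : Matrix (Fin M) (Fin M) ℂ))).re
    - l * ((trace (vecMulVec S.hrb (star S.hrb) * (v.2 : Matrix (Fin N) (Fin N) ℂ))).re
      + S.σb ^ 2)

/-- The feasible set of the semidefinite program that replaces a Dinkelbach step. -/
def sdpFeasible (S : CovertSystem M N) (x₂ : ℝ) : Set (SDPVar M N) :=
  {u | S.PowerConstraints u.1 ∧
    (∀ i, 0 ≤ u.2.1 i ∧ (S.mseMatrix (u.1.2 : Matrix (Fin N) (Fin N) ℂ) i (u.2.1 i)).PosSemidef) ∧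
    ∑ i, u.2.1 i ≤ S.MSEmax ∧ 0 ≤ u.2.2.1 ∧ 0 ≤ u.2.2.2 ∧
    (S.lmiMatrix x₂ u.1.1 u.1.2 u.2.2.1 u.2.2.2).PosSemidef}

end CovertSystem

/-- Maximizing `obj` over `F` is a semidefinite program: the objective is an affine function, and
`F` is described by finitely many linear matrix inequalities, that is, inequalities `A x ⪰ 0` with
`A` a real-affine map into Hermitian matrices. -/
def IsSemidefiniteProgram {V : Type} [AddCommGroup V] [Module ℝ V] (F : Set V) (obj : V → ℝ) :
    Prop :=
  (∃ c : V →ᵃ[ℝ] ℝ, ∀ x, obj x = c x) ∧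
  ∃ (K : Type) (_ : Finite K) (n : K → ℕ) (A : ∀ k, V →ᵃ[ℝ] Matrix (Fin (n k)) (Fin (n k)) ℂ),
    (∀ k x, (A k x).IsHermitian) ∧ ∀ x, x ∈ F ↔ ∀ k, (A k x).PosSemidef

/-- `x` solves the problem of maximizing `obj` over `F`. -/
def IsMaximizer {V : Type} (F : Set V) (obj : V → ℝ) (x : V) : Prop :=
  x ∈ F ∧ ∀ y ∈ F, obj y ≤ obj x

end

/-! ### Kullback–Leibler divergence of circular complex Gaussians -/

section Divergence

open MeasureTheory

/-! The log-likelihood ratio of two circular Gaussians is affine in `‖y‖ ^ 2`, so the divergence has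
the closed form `log (v₁ / v₀) + v₀ / v₁ - 1` (`klDiv_complexGaussian`). The covertness constraint
therefore says that `covertFun` is nonpositive at the power ratio. Its derivative has the sign of `x
- 1`, and its sublevel set is the interval between the two roots. Transmission only adds power, so
the ratio is at least one and only the upper root matters.

The robust constraint asks that a quadratic in one channel error be bounded by a quadratic in the
other, over a product of ellipsoids. An S-lemma with several constraints is in general lossy, but
here the two variables separate: the supremum of the smaller side is a constant lying between both
sides, and the exact S-lemma for one constraint applies to each side (`exists_multipliers`). Adding
the two certificates gives a polynomial that is nonnegative everywhere, and by homogenization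
(`posSemidef_borderMatrix_iff`) this is exactly the linear matrix inequality. The first multiplier
is chosen without reference to the second error, which is why it is uniform in the quadratic matrix
inequality.

The trace bound on the posterior covariance splits into its diagonal entries, each bounded by a
Schur complement. Hence the feasible set of the step is the projection of that of the semidefinite
program, and the objective does not see the extra variables. -/

theorem integral_norm_sq_pow_mul_exp_complex {v : ℝ} (hv : 0 < v) :
    ∫ y : ℂ, Real.exp (-(‖y‖ ^ 2 / v)) = Real.pi * v ∧
      ∫ y : ℂ, ‖y‖ ^ 2 * Real.exp (-(‖y‖ ^ 2 / v)) = Real.pi * v ^ 2 := by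
  have e : ∀ y : ℂ, -v⁻¹ * ‖y‖ ^ (2 : ℝ) = -(‖y‖ ^ 2 / v) := fun y => by
    rw [Real.rpow_two]; ring
  constructor
  · have h := Complex.integral_exp_neg_mul_rpow (p := 2) (b := v⁻¹) (by norm_num) (by positivity)
    simp only [e] at h
    rw [h, show (-2 / 2 : ℝ) = -1 by norm_num, Real.rpow_neg_one, inv_inv,
      show (2 / 2 + 1 : ℝ) = 2 by norm_num, Real.Gamma_two, mul_one]
  · have h := Complex.integral_rpow_mul_exp_neg_mul_rpow (p := 2) (q := 2) (b := v⁻¹)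
      (by norm_num) (by norm_num) (by positivity)
    simp only [e] at h
    simp only [Real.rpow_two] at h
    rw [h, show (-(2 + 2) / 2 : ℝ) = -(2 : ℝ) by norm_num, Real.rpow_neg (by positivity),
      Real.rpow_two, show ((2 + 2) / 2 : ℝ) = 2 by norm_num, Real.Gamma_two]
    field_simp

/-- The Bochner integral of a non-integrable function is zero, so a nonzero value already certifies
integrability. -/
theorem integrable_exp_neg_norm_sq_div {v : ℝ} (hv : 0 < v) :
    Integrable fun y : ℂ => Real.exp (-(‖y‖ ^ 2 / v)) :=
  Integrable.of_integral_ne_zero (by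
    rw [(integral_norm_sq_pow_mul_exp_complex hv).1]; positivity)

theorem integrable_norm_sq_mul_exp_neg_norm_sq_div {v : ℝ} (hv : 0 < v) :
    Integrable fun y : ℂ => ‖y‖ ^ 2 * Real.exp (-(‖y‖ ^ 2 / v)) :=
  Integrable.of_integral_ne_zero (by
    rw [(integral_norm_sq_pow_mul_exp_complex hv).2]; positivity)

theorem isProbabilityMeasure_complexGaussian {v : ℝ} (hv : 0 < v) :
    IsProbabilityMeasure (complexGaussian v) := by
  constructor
  rw [complexGaussian, withDensity_apply _ MeasurableSet.univ, Measure.restrict_univ,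
    ← ofReal_integral_eq_lintegral_ofReal ((integrable_exp_neg_norm_sq_div hv).const_mul _)
      (ae_of_all _ fun y => by positivity), integral_const_mul,
    (integral_norm_sq_pow_mul_exp_complex hv).1]
  have := Real.pi_pos
  rw [one_div_mul_cancel (by positivity), ENNReal.ofReal_one]

theorem measurable_complexGaussian_density (v : ℝ) : Measurable fun y : ℂ =>
    ENNReal.ofReal (1 / (Real.pi * v) * Real.exp (-(‖y‖ ^ 2 / v))) := by
  fun_prop

theorem integrable_complexGaussian_affine_norm_sq {v : ℝ} (hv : 0 < v) (a b : ℝ) :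
    Integrable (fun y : ℂ => a + b * ‖y‖ ^ 2) (complexGaussian v) ∧
      ∫ y, (a + b * ‖y‖ ^ 2) ∂complexGaussian v = a + b * v := by
  have hpi := Real.pi_pos
  have e : ∀ y : ℂ, (ENNReal.ofReal (1 / (Real.pi * v) * Real.exp (-(‖y‖ ^ 2 / v)))).toReal •
      (a + b * ‖y‖ ^ 2) = (1 / (Real.pi * v)) * (a * Real.exp (-(‖y‖ ^ 2 / v)) +
        b * (‖y‖ ^ 2 * Real.exp (-(‖y‖ ^ 2 / v)))) := fun y => by
    rw [ENNReal.toReal_ofReal (by positivity), smul_eq_mul]; ring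
  have h0 := (integrable_exp_neg_norm_sq_div hv).const_mul a
  have h1 := (integrable_norm_sq_mul_exp_neg_norm_sq_div hv).const_mul b
  constructor
  · rw [complexGaussian, integrable_withDensity_iff_integrable_smul'
      (measurable_complexGaussian_density v) (ae_of_all _ fun _ => ENNReal.ofReal_lt_top)]
    simp only [e]
    exact (h0.add h1).const_mul _
  · rw [complexGaussian, integral_withDensity_eq_integral_toReal_smul
      (measurable_complexGaussian_density v) (ae_of_all _ fun _ => ENNReal.ofReal_lt_top)]
    simp only [e]
    rw [integral_const_mul, integral_add h0 h1, integral_const_mul, integral_const_mul,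
      (integral_norm_sq_pow_mul_exp_complex hv).1, (integral_norm_sq_pow_mul_exp_complex hv).2]
    field_simp

/-- An explicit relative density yields both the absolute continuity and the log-likelihood ratio
needed for the divergence. -/
theorem complexGaussian_eq_withDensity {v₀ v₁ : ℝ} (h₀ : 0 < v₀) (h₁ : 0 < v₁) :
    complexGaussian v₀ = (complexGaussian v₁).withDensity fun y =>
      ENNReal.ofReal (v₁ / v₀ * Real.exp ((1 / v₁ - 1 / v₀) * ‖y‖ ^ 2)) := by
  have hpi := Real.pi_pos
  rw [complexGaussian, complexGaussian,
    ← withDensity_mul _ (measurable_complexGaussian_density v₁) (by fun_prop)]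
  congr 1
  ext y
  rw [Pi.mul_apply, ← ENNReal.ofReal_mul (by positivity)]
  congr 1
  rw [show -(‖y‖ ^ 2 / v₀) = -(‖y‖ ^ 2 / v₁) + (1 / v₁ - 1 / v₀) * ‖y‖ ^ 2 by ring, Real.exp_add]
  field_simp

theorem klDiv_complexGaussian {v₀ v₁ : ℝ} (h₀ : 0 < v₀) (h₁ : 0 < v₁) :
    InformationTheory.klDiv (complexGaussian v₀) (complexGaussian v₁) =
      ENNReal.ofReal (Real.log (v₁ / v₀) + v₀ / v₁ - 1) := by
  have := isProbabilityMeasure_complexGaussian h₀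
  have := isProbabilityMeasure_complexGaussian h₁
  have hac : complexGaussian v₀ ≪ complexGaussian v₁ := by
    rw [complexGaussian_eq_withDensity h₀ h₁]
    exact withDensity_absolutelyContinuous _ _
  have hllr : llr (complexGaussian v₀) (complexGaussian v₁) =ᵐ[complexGaussian v₀]
      fun y => Real.log (v₁ / v₀) + (1 / v₁ - 1 / v₀) * ‖y‖ ^ 2 := by
    have h := Measure.rnDeriv_withDensity (complexGaussian v₁)
      (f := fun y => ENNReal.ofReal (v₁ / v₀ * Real.exp ((1 / v₁ - 1 / v₀) * ‖y‖ ^ 2)))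
      (by fun_prop)
    rw [← complexGaussian_eq_withDensity h₀ h₁] at h
    -- The derivative is known almost everywhere for the second law; absolute continuity transports
    -- this to the first.
    filter_upwards [hac.ae_eq h] with y hy
    rw [llr, hy, ENNReal.toReal_ofReal (by positivity),
      Real.log_mul (by positivity) (Real.exp_ne_zero _), Real.log_exp]
  have hI := integrable_complexGaussian_affine_norm_sq h₀ (Real.log (v₁ / v₀)) (1 / v₁ - 1 / v₀)
  rw [InformationTheory.klDiv_of_ac_of_integrable hac (hI.1.congr hllr.symm),
    integral_congr_ae hllr, hI.2]
  congr 1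
  -- The general formula for `klDiv` carries a correction by the total masses, which cancels for
  -- probability measures.
  simp only [probReal_univ]
  field_simp
  ring

end Divergence

/-! ### Shape and roots of the scalar function -/

section CovertFun

theorem hasDerivAt_covertFun (ε : ℝ) {x : ℝ} (hx : 0 < x) :
    HasDerivAt (covertFun ε) ((x - 1) / x ^ 2) x := by
  have h : HasDerivAt (fun y : ℝ => Real.log y + y⁻¹ - 1 - 2 * ε ^ 2) (x⁻¹ + -(x ^ 2)⁻¹) x :=
    (((Real.hasDerivAt_log hx.ne').fun_add (hasDerivAt_inv hx.ne')).sub_const 1).sub_const _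
  have e : covertFun ε = fun y : ℝ => Real.log y + y⁻¹ - 1 - 2 * ε ^ 2 := by
    ext y; simp [covertFun]
  rw [e]
  convert h using 1
  field_simp
  ring

theorem strictAntiOn_covertFun (ε : ℝ) : StrictAntiOn (covertFun ε) (Set.Ioc 0 1) := by
  refine strictAntiOn_of_deriv_neg (convex_Ioc 0 1)
    (fun x hx => (hasDerivAt_covertFun ε hx.1).continuousAt.continuousWithinAt) fun x hx => ?_
  rw [interior_Ioc] at hx
  rw [(hasDerivAt_covertFun ε hx.1).deriv]
  exact div_neg_of_neg_of_pos (by linarith [hx.2]) (by have := hx.1; positivity)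

theorem strictMonoOn_covertFun (ε : ℝ) : StrictMonoOn (covertFun ε) (Set.Ici 1) := by
  have hpos : ∀ x ∈ Set.Ici (1 : ℝ), 0 < x := fun x hx => lt_of_lt_of_le one_pos hx
  refine strictMonoOn_of_deriv_pos (convex_Ici 1)
    (fun x hx => (hasDerivAt_covertFun ε (hpos x hx)).continuousAt.continuousWithinAt)
    fun x hx => ?_
  rw [interior_Ici] at hx
  have h1 : (1 : ℝ) < x := hx
  have h0 : 0 < x := by linarith
  rw [(hasDerivAt_covertFun ε h0).deriv]
  exact div_pos (by linarith) (by positivity)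

theorem exists_covertFun_roots {ε : ℝ} (hε : 0 < ε) :
    ∃ x₁ x₂ : ℝ, 0 < x₁ ∧ x₁ < 1 ∧ 1 < x₂ ∧ covertFun ε x₁ = 0 ∧ covertFun ε x₂ = 0 := by
  have hneg : covertFun ε 1 < 0 := by
    simp only [covertFun, Real.log_one]; nlinarith [sq_nonneg ε, mul_pos hε hε]
  have hcont : ∀ s : Set ℝ, (∀ x ∈ s, 0 < x) → ContinuousOn (covertFun ε) s := fun s hs x hx =>
    (hasDerivAt_covertFun ε (hs x hx)).continuousAt.continuousWithinAt
  -- At `exp (-2ε)` the value is `exp (2ε) - 1 - 2ε - 2ε²`, nonnegative by the second-order Taylor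
  -- bound.
  have ha : 0 ≤ covertFun ε (Real.exp (-(2 * ε))) := by
    have := Real.quadratic_le_exp_of_nonneg (x := 2 * ε) (by positivity)
    rw [covertFun, Real.log_exp, one_div, ← Real.exp_neg, neg_neg]
    linarith
  -- Here the logarithm cancels the constants exactly and leaves a positive exponential.
  have hb : 0 ≤ covertFun ε (Real.exp (1 + 2 * ε ^ 2)) := by
    rw [covertFun, Real.log_exp, one_div, ← Real.exp_neg]
    have := Real.exp_pos (-(1 + 2 * ε ^ 2))
    linarith
  have ha1 : Real.exp (-(2 * ε)) ≤ 1 := Real.exp_le_one_iff.2 (by linarith)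
  have hb1 : 1 ≤ Real.exp (1 + 2 * ε ^ 2) := Real.one_le_exp (by positivity)
  obtain ⟨x₁, ⟨h1a, h1b⟩, h1⟩ := intermediate_value_Icc' ha1
    (hcont _ fun x hx => (Real.exp_pos _).trans_le hx.1) ⟨hneg.le, ha⟩
  obtain ⟨x₂, ⟨h2a, h2b⟩, h2⟩ := intermediate_value_Icc hb1
    (hcont _ fun x hx => one_pos.trans_le hx.1) ⟨hneg.le, hb⟩
  refine ⟨x₁, x₂, (Real.exp_pos _).trans_le h1a, lt_of_le_of_ne h1b ?_, lt_of_le_of_ne h2a ?_,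
    h1, h2⟩
  · rintro rfl; exact hneg.ne h1
  · rintro rfl; exact hneg.ne h2

theorem covertFun_nonpos_iff {ε x₁ x₂ : ℝ} (h0 : 0 < x₁) (h1 : x₁ < 1) (h2 : 1 < x₂)
    (hx₁ : covertFun ε x₁ = 0) (hx₂ : covertFun ε x₂ = 0) {x : ℝ} (hx : 0 < x) :
    covertFun ε x ≤ 0 ↔ x₁ ≤ x ∧ x ≤ x₂ := by
  rcases le_total x 1 with h | h
  · rw [← hx₁, (strictAntiOn_covertFun ε).le_iff_ge ⟨hx, h⟩ ⟨h0, h1.le⟩]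
    exact ⟨fun hh => ⟨hh, by linarith⟩, fun hh => hh.1⟩
  · rw [← hx₂, (strictMonoOn_covertFun ε).le_iff_le (Set.mem_Ici.2 h) (Set.mem_Ici.2 h2.le)]
    exact ⟨fun hh => ⟨by linarith, hh⟩, fun hh => hh.2⟩

theorem covertFun_eq_zero_iff {ε x₁ x₂ : ℝ} (h0 : 0 < x₁) (h1 : x₁ < 1) (h2 : 1 < x₂)
    (hx₁ : covertFun ε x₁ = 0) (hx₂ : covertFun ε x₂ = 0) {x : ℝ} (hx : 0 < x) :
    covertFun ε x = 0 ↔ x = x₁ ∨ x = x₂ := by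
  refine ⟨fun h => ?_, by rintro (rfl | rfl) <;> assumption⟩
  rcases le_total x 1 with h' | h'
  · exact Or.inl ((strictAntiOn_covertFun ε).injOn ⟨hx, h'⟩ ⟨h0, h1.le⟩ (h.trans hx₁.symm))
  · exact Or.inr ((strictMonoOn_covertFun ε).injOn (Set.mem_Ici.2 h') (Set.mem_Ici.2 h2.le)
      (h.trans hx₂.symm))

theorem klDiv_complexGaussian_le_iff {ε v₀ v₁ : ℝ} (h₀ : 0 < v₀) (h₁ : 0 < v₁) :
    InformationTheory.klDiv (complexGaussian v₀) (complexGaussian v₁) ≤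
      ENNReal.ofReal (2 * ε ^ 2) ↔ covertFun ε (v₁ / v₀) ≤ 0 := by
  rw [klDiv_complexGaussian h₀ h₁, ENNReal.ofReal_le_ofReal_iff (by positivity), covertFun,
    one_div_div, sub_nonpos]

end CovertFun

/-! ### Hermitian forms, homogenization and the S-lemma -/

section HermitianForms

variable {n m : Type*} [Fintype n] [Fintype m]

/-- The real part of `xᴴ A x`, over an arbitrary finite index type. -/
noncomputable def hermForm (A : Matrix n n ℂ) (x : n → ℂ) : ℝ := (star x ⬝ᵥ A *ᵥ x).re

theorem quadForm_eq_hermForm {k : ℕ} (A : Matrix (Fin k) (Fin k) ℂ) (x : Fin k → ℂ) :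
    quadForm A x = hermForm A x := rfl

theorem dotProduct_mulVec_conj {A : Matrix n n ℂ} (hA : A.IsHermitian) (x y : n → ℂ) :
    star (star x ⬝ᵥ A *ᵥ y) = star y ⬝ᵥ A *ᵥ x := by
  rw [← star_dotProduct_star, star_star, star_mulVec, hA.eq, dotProduct_comm, dotProduct_mulVec,
    dotProduct_comm]

theorem coe_hermForm {A : Matrix n n ℂ} (hA : A.IsHermitian) (x : n → ℂ) :
    (hermForm A x : ℂ) = star x ⬝ᵥ A *ᵥ x :=
  Complex.conj_eq_iff_re.1 (dotProduct_mulVec_conj hA x x)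

theorem posSemidef_iff_hermForm {A : Matrix n n ℂ} :
    A.PosSemidef ↔ A.IsHermitian ∧ ∀ x, 0 ≤ hermForm A x := by
  rw [posSemidef_iff_dotProduct_mulVec]
  refine and_congr_right fun hA => forall_congr' fun x => ?_
  rw [← coe_hermForm hA, Complex.zero_le_real]

theorem hermForm_add {A : Matrix n n ℂ} (hA : A.IsHermitian) (x y : n → ℂ) :
    hermForm A (x + y) = hermForm A x + 2 * (star x ⬝ᵥ A *ᵥ y).re + hermForm A y := by
  have h : (star y ⬝ᵥ A *ᵥ x).re = (star x ⬝ᵥ A *ᵥ y).re := by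
    rw [← dotProduct_mulVec_conj hA]; simp
  simp only [hermForm, star_add, mulVec_add, dotProduct_add, add_dotProduct, Complex.add_re, h]
  ring

theorem hermForm_smul (A : Matrix n n ℂ) (c : ℂ) (x : n → ℂ) :
    hermForm A (c • x) = ‖c‖ ^ 2 * hermForm A x := by
  have h : star (c • x) ⬝ᵥ A *ᵥ (c • x) = ((‖c‖ ^ 2 : ℝ) : ℂ) * (star x ⬝ᵥ A *ᵥ x) := by
    rw [star_smul, mulVec_smul, smul_dotProduct, dotProduct_smul, smul_smul, smul_eq_mul,
      Complex.star_def, Complex.conj_mul']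
    push_cast; rfl
  rw [hermForm, h, Complex.re_ofReal_mul, hermForm]

theorem hermForm_zero_right (A : Matrix n n ℂ) : hermForm A 0 = 0 := by simp [hermForm]

theorem hermForm_add_left (A B : Matrix n n ℂ) (x : n → ℂ) :
    hermForm (A + B) x = hermForm A x + hermForm B x := by
  simp [hermForm, add_mulVec, dotProduct_add]

theorem hermForm_sub_left (A B : Matrix n n ℂ) (x : n → ℂ) :
    hermForm (A - B) x = hermForm A x - hermForm B x := by
  simp [hermForm, sub_mulVec, dotProduct_sub]

theorem hermForm_smul_left (r : ℝ) (A : Matrix n n ℂ) (x : n → ℂ) :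
    hermForm (r • A) x = r * hermForm A x := by
  simp [hermForm, smul_mulVec, dotProduct_smul]

theorem hermForm_vecMulVec (w x : n → ℂ) :
    hermForm (vecMulVec w (star w)) x = ‖star x ⬝ᵥ w‖ ^ 2 := by
  have h : star w ⬝ᵥ x = star (star x ⬝ᵥ w) := by
    rw [← star_dotProduct_star, star_star]
  rw [hermForm, vecMulVec_mulVec, dotProduct_smul, h]
  simp [← Complex.normSq_eq_norm_sq, Complex.mul_conj]

omit [Fintype n] in
theorem isHermitian_smul_real {A : Matrix n n ℂ} (hA : A.IsHermitian) (r : ℝ) :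
    (r • A).IsHermitian := by
  rw [IsHermitian, conjTranspose_smul, star_trivial, hA.eq]

/-- Over `ℂ` the phase of a vector is free: one rotation makes the second number purely imaginary,
and the remaining choice of sign fixes the real part of the first. This freedom controls both cross
terms in the S-lemma at once. -/
theorem exists_phase (α β : ℂ) : ∃ u : ℂ, ‖u‖ = 1 ∧ (u * β).re = 0 ∧ (u * α).re ≤ 0 := by
  obtain ⟨u, hu, huβ⟩ : ∃ u : ℂ, ‖u‖ = 1 ∧ (u * β).re = 0 := by
    by_cases hβ : β = 0
    · exact ⟨1, by simp, by simp [hβ]⟩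
    · refine ⟨Complex.I * star β / ‖β‖, by simp [hβ], ?_⟩
      have : Complex.I * star β / ‖β‖ * β = Complex.I * ((‖β‖ : ℝ) : ℂ) := by
        have hb : ((‖β‖ : ℝ) : ℂ) ≠ 0 := by simpa using hβ
        rw [div_mul_eq_mul_div, mul_assoc, Complex.star_def, Complex.conj_mul']
        field_simp
      rw [this]; simp
  rcases le_total (u * α).re 0 with h | h
  · exact ⟨u, hu, huβ, h⟩
  · exact ⟨-u, by simpa, by rw [neg_mul, Complex.neg_re, huβ, neg_zero],
      by rw [neg_mul, Complex.neg_re]; linarith⟩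

/-- The S-lemma for two Hermitian forms. -/
theorem hermForm_sLemma {A B : Matrix n n ℂ} (hA : A.IsHermitian) (hB : B.IsHermitian)
    (hpos : ∃ x, 0 < hermForm B x) (h : ∀ x, 0 ≤ hermForm B x → 0 ≤ hermForm A x) :
    ∃ μ : ℝ, 0 ≤ μ ∧ ∀ x, 0 ≤ hermForm A x - μ * hermForm B x := by
  -- Ratios `A / B` at points with `B < 0` never exceed those at points with `B > 0`. To compare `x`
  -- and `y`, combine them into a null vector of `B`, where `A` is nonnegative by hypothesis.
  have key : ∀ x y, 0 < hermForm B x → hermForm B y < 0 →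
      hermForm A x * hermForm B y ≤ hermForm A y * hermForm B x := by
    intro x y hx hy
    obtain ⟨u, hu, huB, huA⟩ := exists_phase (star x ⬝ᵥ A *ᵥ y) (star x ⬝ᵥ B *ᵥ y)
    -- With the cross term of `B` removed by the phase, this scaling makes the two remaining terms
    -- cancel.
    set s : ℝ := Real.sqrt (-hermForm B y / hermForm B x) with hs
    have hs2 : s ^ 2 = -hermForm B y / hermForm B x :=
      Real.sq_sqrt (div_nonneg (by linarith) hx.le)
    have hs0 : 0 ≤ s := Real.sqrt_nonneg _
    have hn : ‖(s : ℂ) * star u‖ ^ 2 = s ^ 2 := by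
      rw [norm_mul, norm_star, hu, mul_one, Complex.norm_real, Real.norm_eq_abs, sq_abs]
    have hc : ∀ D : Matrix n n ℂ, (star (((s : ℂ) * star u) • x) ⬝ᵥ D *ᵥ y).re =
        s * (u * (star x ⬝ᵥ D *ᵥ y)).re := fun D => by
      rw [star_smul, smul_dotProduct, star_mul', star_star, Complex.star_def, Complex.conj_ofReal,
        smul_eq_mul, mul_assoc, Complex.re_ofReal_mul]
    have hBz : hermForm B (((s : ℂ) * star u) • x + y) = 0 := by
      rw [hermForm_add hB, hc, hermForm_smul, hn, huB, hs2]
      field_simp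
      ring
    have hAz := h _ hBz.ge
    rw [hermForm_add hA, hc, hermForm_smul, hn, hs2] at hAz
    have h1 : 0 ≤ -hermForm B y / hermForm B x * hermForm A x + hermForm A y := by
      have := mul_nonpos_of_nonneg_of_nonpos hs0 huA
      linarith
    have h2 := mul_nonneg h1 hx.le
    have h3 : (-hermForm B y / hermForm B x * hermForm A x + hermForm A y) * hermForm B x =
        -hermForm B y * hermForm A x + hermForm A y * hermForm B x := by
      field_simp
    linarith
  -- The multiplier is the infimum of the ratios on the positive side; `key` places it above all
  -- ratios on the negative side.
  set T : Set ℝ := {r | ∃ x, 0 < hermForm B x ∧ r = hermForm A x / hermForm B x} with hT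
  have hT0 : ∀ r ∈ T, 0 ≤ r := by
    rintro r ⟨x, hx, rfl⟩
    exact div_nonneg (h x hx.le) hx.le
  have hTne : T.Nonempty := let ⟨x, hx⟩ := hpos; ⟨_, x, hx, rfl⟩
  refine ⟨sInf T, le_csInf hTne hT0, fun x => ?_⟩
  rcases lt_trichotomy (hermForm B x) 0 with hx | hx | hx
  · have : hermForm A x / hermForm B x ≤ sInf T := by
      refine le_csInf hTne ?_
      rintro r ⟨y, hy, rfl⟩
      rw [div_le_iff_of_neg hx, div_mul_eq_mul_div, div_le_iff₀ hy]
      exact key y x hy hx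
    rw [div_le_iff_of_neg hx] at this
    linarith
  · rw [hx, mul_zero, sub_zero]; exact h x hx.ge
  · have : sInf T ≤ hermForm A x / hermForm B x := csInf_le ⟨0, hT0⟩ ⟨x, hx, rfl⟩
    rw [le_div_iff₀ hx] at this
    linarith

/-- The matrix `[A, b; bᴴ, c]`. -/
def borderMatrix (A : Matrix n n ℂ) (b : n → ℂ) (c : ℝ) : Matrix (n ⊕ Unit) (n ⊕ Unit) ℂ :=
  fromBlocks A (replicateCol Unit b) (replicateRow Unit (star b)) (of fun _ _ => (c : ℂ))

omit [Fintype n] in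
theorem isHermitian_borderMatrix {A : Matrix n n ℂ} (hA : A.IsHermitian) (b : n → ℂ) (c : ℝ) :
    (borderMatrix A b c).IsHermitian := by
  refine IsHermitian.fromBlocks hA ?_ ?_
  · ext i j; simp
  · ext i j; simp

theorem hermForm_borderMatrix (A : Matrix n n ℂ) (b : n → ℂ) (c : ℝ) (x : n → ℂ) (τ : ℂ) :
    hermForm (borderMatrix A b c) (Sum.elim x fun _ => τ) =
      hermForm A x + 2 * (star τ * (star b ⬝ᵥ x)).re + c * ‖τ‖ ^ 2 := by
  have h1 : star (Sum.elim x fun _ : Unit => τ) = Sum.elim (star x) (fun _ => star τ) := by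
    ext (i | i) <;> rfl
  have h2 (a b : ℂ) : (fun _ : Unit => a) ⬝ᵥ (fun _ => b) = a * b := by simp [dotProduct]
  have h3 : star x ⬝ᵥ b = star (star b ⬝ᵥ x) := by
    rw [← star_dotProduct_star, star_star]
  have h4 : borderMatrix A b c *ᵥ (Sum.elim x fun _ => τ) =
      Sum.elim (A *ᵥ x + τ • b) (fun _ => star b ⬝ᵥ x + c * τ) := by
    ext (i | i) <;>
      simp [borderMatrix, mulVec, dotProduct, Fintype.sum_sum_type, mul_comm]
  rw [hermForm, h1, h4, sumElim_dotProduct_sumElim, dotProduct_add, dotProduct_smul, h3]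
  have h5 : (‖τ‖ : ℝ) ^ 2 = τ.re * τ.re + τ.im * τ.im := by
    rw [← Complex.normSq_eq_norm_sq, Complex.normSq_apply]
  simp only [h2, hermForm, h5, Complex.add_re, smul_eq_mul, Complex.mul_re, Complex.star_def,
    Complex.conj_re, Complex.conj_im, Complex.ofReal_re, Complex.ofReal_im, Complex.add_im,
    Complex.mul_im]
  ring

/-- This recovers the form at a point at infinity (last homogeneous coordinate zero) from the values
of the polynomial along a line. -/
theorem nonneg_of_forall_quadratic {a b c : ℝ} (h : ∀ t : ℝ, 0 ≤ a * t ^ 2 + b * t + c) :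
    0 ≤ a := by
  by_contra ha
  push Not at ha
  -- The test point is at least `1` and makes `a * t + b ≤ -(|c| + 1)`, so the quadratic is negative
  -- there.
  have h1 := h ((|b| + |c| + 1) / -a + 1)
  set t := (|b| + |c| + 1) / -a + 1 with ht
  have hd : 0 ≤ (|b| + |c| + 1) / -a := div_nonneg (by positivity) (by linarith)
  have ht1 : 1 ≤ t := by linarith
  have hat : a * t = -(|b| + |c| + 1) + a := by
    have ha0 : a ≠ 0 := ha.ne
    rw [ht]
    field_simp
  have h2 : a * t ^ 2 + b * t + c = (a * t + b) * t + c := by ring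
  have h3 : a * t + b ≤ -(|c| + 1) := by linarith [le_abs_self b]
  nlinarith [le_abs_self c, abs_nonneg c]

/-- The quadratic polynomial `x ↦ xᴴ A x + 2 Re (bᴴ x) + c`. -/
noncomputable def hermPoly (A : Matrix n n ℂ) (b : n → ℂ) (c : ℝ) (x : n → ℂ) : ℝ :=
  hermForm A x + 2 * (star b ⬝ᵥ x).re + c

theorem hermPoly_real_smul (A : Matrix n n ℂ) (b : n → ℂ) (c t : ℝ) (x : n → ℂ) :
    hermPoly A b c ((t : ℂ) • x) = hermForm A x * t ^ 2 + 2 * (star b ⬝ᵥ x).re * t + c := by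
  rw [hermPoly, hermForm_smul, dotProduct_smul, smul_eq_mul, Complex.re_ofReal_mul,
    Complex.norm_real, Real.norm_eq_abs, sq_abs]
  ring

theorem hermForm_borderMatrix_eq_hermPoly (A : Matrix n n ℂ) (b : n → ℂ) (c : ℝ) (x : n → ℂ)
    {τ : ℂ} (hτ : τ ≠ 0) :
    hermForm (borderMatrix A b c) (Sum.elim x fun _ => τ) =
      ‖τ‖ ^ 2 * hermPoly A b c (τ⁻¹ • x) := by
  have h : (Sum.elim x fun _ : Unit => τ) = τ • Sum.elim (τ⁻¹ • x) fun _ => 1 := by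
    ext (i | i) <;> simp [hτ]
  rw [h, hermForm_smul, hermForm_borderMatrix, hermPoly]
  simp

/-- The bordered matrix is the homogenization of the polynomial. Vectors with nonzero last
coordinate rescale to affine points; for the others only the leading form survives. -/
theorem posSemidef_borderMatrix_iff {A : Matrix n n ℂ} (hA : A.IsHermitian) (b : n → ℂ) (c : ℝ) :
    (borderMatrix A b c).PosSemidef ↔ ∀ x, 0 ≤ hermPoly A b c x := by
  rw [posSemidef_iff_hermForm, and_iff_right (isHermitian_borderMatrix hA b c)]
  constructor
  · intro h x
    have := h (Sum.elim x fun _ => 1)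
    rwa [hermForm_borderMatrix_eq_hermPoly _ _ _ _ one_ne_zero, norm_one, one_pow, one_mul,
      inv_one, one_smul] at this
  · intro h z
    obtain ⟨x, τ, rfl⟩ : ∃ x τ, z = Sum.elim x fun _ => τ :=
      ⟨z ∘ Sum.inl, z (Sum.inr ()), by ext (i | i) <;> rfl⟩
    by_cases hτ : τ = 0
    · subst hτ
      have := nonneg_of_forall_quadratic fun t => (hermPoly_real_smul A b c t x) ▸ h _
      rw [hermForm_borderMatrix]
      simpa using this
    · rw [hermForm_borderMatrix_eq_hermPoly _ _ _ _ hτ]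
      exact mul_nonneg (by positivity) (h _)

/-- The S-lemma for a quadratic polynomial on an ellipsoid `xᴴ C x ≤ r`. -/
theorem hermPoly_sLemma {A C : Matrix n n ℂ} (hA : A.IsHermitian) (hC : C.IsHermitian)
    (b : n → ℂ) (c : ℝ) {r : ℝ} (hr : 0 < r)
    (h : ∀ x, hermForm C x ≤ r → 0 ≤ hermPoly A b c x) :
    ∃ μ : ℝ, 0 ≤ μ ∧ ∀ x, 0 ≤ hermPoly A b c x - μ * (r - hermForm C x) := by
  have hC' : ∀ x, hermPoly (-C) 0 r x = r - hermForm C x := fun x => by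
    have := hermForm_sub_left 0 C x
    rw [zero_sub] at this
    rw [hermPoly, this]
    simp [hermForm]
    ring
  -- The S-lemma is applied to the homogenizations; the centre of the ellipsoid, where the
  -- constraint has value `r > 0`, is the strictly feasible point.
  obtain ⟨μ, hμ, hh⟩ := hermForm_sLemma (isHermitian_borderMatrix hA b c)
    (isHermitian_borderMatrix hC.neg 0 r) ⟨Sum.elim 0 fun _ => 1, by
      rw [hermForm_borderMatrix_eq_hermPoly _ _ _ _ one_ne_zero, hC']
      simpa [hermForm_zero_right] using hr⟩ (by
      intro z
      obtain ⟨x, τ, rfl⟩ : ∃ x τ, z = Sum.elim x fun _ => τ :=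
        ⟨z ∘ Sum.inl, z (Sum.inr ()), by ext (i | i) <;> rfl⟩
      by_cases hτ : τ = 0
      · subst hτ
        intro hx
        have hx' : hermForm C x ≤ 0 := by
          have h0 := hermForm_sub_left 0 C x
          rw [zero_sub] at h0
          rw [hermForm_borderMatrix, h0] at hx
          simpa [hermForm] using hx
        -- A direction with `hermForm C x ≤ 0` spans a real line inside the ellipsoid, so the
        -- leading coefficient along it is nonnegative. No boundedness of the ellipsoid is needed.
        have := nonneg_of_forall_quadratic fun t => (hermPoly_real_smul A b c t x) ▸ h _ (by
          rw [hermForm_smul]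
          exact (mul_nonpos_of_nonneg_of_nonpos (by positivity) hx').trans hr.le)
        rw [hermForm_borderMatrix]
        simpa using this
      · have hτ' : 0 < ‖τ‖ ^ 2 := by positivity
        rw [hermForm_borderMatrix_eq_hermPoly _ _ _ _ hτ,
          hermForm_borderMatrix_eq_hermPoly _ _ _ _ hτ, mul_nonneg_iff_of_pos_left hτ',
          mul_nonneg_iff_of_pos_left hτ', hC', sub_nonneg]
        exact h _)
  refine ⟨μ, hμ, fun x => ?_⟩
  have := hh (Sum.elim x fun _ => 1)
  rwa [hermForm_borderMatrix_eq_hermPoly _ _ _ _ one_ne_zero,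
    hermForm_borderMatrix_eq_hermPoly _ _ _ _ one_ne_zero, norm_one, one_pow, one_mul, one_mul,
    inv_one, one_smul, hC'] at this

end HermitianForms

/-! ### Decoupling a constraint over two ellipsoids -/

section Robust

variable {n m : Type*} [Fintype n] [Fintype m]

theorem star_mulVec_dotProduct {A : Matrix n n ℂ} (hA : A.IsHermitian) (h x : n → ℂ) :
    star (A *ᵥ h) ⬝ᵥ x = star h ⬝ᵥ A *ᵥ x := by
  rw [star_mulVec, hA.eq, ← dotProduct_mulVec]

theorem hermForm_add_eq_hermPoly {A : Matrix n n ℂ} (hA : A.IsHermitian) (h : n → ℂ) (c : ℝ)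
    (x : n → ℂ) : hermForm A (h + x) + c = hermPoly A (A *ᵥ h) (hermForm A h + c) x := by
  rw [hermForm_add hA, hermPoly, star_mulVec_dotProduct hA]
  ring

theorem hermForm_neg_left (A : Matrix n n ℂ) (x : n → ℂ) : hermForm (-A) x = -hermForm A x := by
  simp [hermForm, neg_mulVec]

theorem hermForm_fromBlocks_diagonal (A : Matrix n n ℂ) (D : Matrix m m ℂ) (x : n → ℂ)
    (y : m → ℂ) :
    hermForm (fromBlocks A 0 0 D) (Sum.elim x y) = hermForm A x + hermForm D y := by
  have h1 : star (Sum.elim x y) = Sum.elim (star x) (star y) := by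
    ext (i | i) <;> rfl
  rw [hermForm, h1, fromBlocks_mulVec, sumElim_dotProduct_sumElim]
  simp [hermForm, Function.comp_def]

/-- A constraint `R y ≤ P x` for all `x`, `y` in two ellipsoids, with `P`, `R` quadratic, has
multipliers certifying it for all `x`, `y`. -/
theorem exists_multipliers {A C : Matrix n n ℂ} {B D : Matrix m m ℂ} (hA : A.IsHermitian)
    (hB : B.IsHermitian) (hC : C.IsHermitian) (hD : D.IsHermitian) (h : n → ℂ) (g : m → ℂ)
    (q : ℝ) {r s : ℝ} (hr : 0 < r) (hs : 0 < s)
    (H : ∀ y, hermForm D y ≤ s → ∀ x, hermForm C x ≤ r →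
      hermForm B (g + y) ≤ hermForm A (h + x) + q) :
    ∃ μ ν : ℝ, 0 ≤ μ ∧ 0 ≤ ν ∧ ∀ x y, 0 ≤ hermForm A (h + x) + q - hermForm B (g + y)
      - μ * (r - hermForm C x) - ν * (s - hermForm D y) := by
  -- The supremum of these values separates the variables: it lies below the quadratic in `x` and
  -- above the one in `y`, each on its own ellipsoid.
  set T : Set ℝ := (fun y => hermForm B (g + y)) '' {y | hermForm D y ≤ s} with hT
  have hT0 : T.Nonempty := ⟨_, 0, by simpa [hermForm_zero_right] using hs.le, rfl⟩
  -- The ellipsoid may be unbounded; the bound comes from the constraint at `x = 0`.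
  have hTb : BddAbove T := by
    refine ⟨hermForm A (h + 0) + q, ?_⟩
    rintro _ ⟨y, hy, rfl⟩
    exact H y hy 0 (by simpa [hermForm_zero_right] using hr.le)
  obtain ⟨μ, hμ, h1⟩ := hermPoly_sLemma hA hC (A *ᵥ h) (hermForm A h + (q - sSup T)) hr
    (fun x hx => by
      rw [← hermForm_add_eq_hermPoly hA]
      have : sSup T ≤ hermForm A (h + x) + q := csSup_le hT0 (by
        rintro _ ⟨y, hy, rfl⟩
        exact H y hy x hx)
      linarith)
  obtain ⟨ν, hν, h2⟩ := hermPoly_sLemma hB.neg hD (-B *ᵥ g) (hermForm (-B) g + sSup T) hs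
    (fun y hy => by
      rw [← hermForm_add_eq_hermPoly hB.neg, hermForm_neg_left]
      have := le_csSup hTb ⟨y, hy, rfl⟩
      simp only at this
      linarith)
  refine ⟨μ, ν, hμ, hν, fun x y => ?_⟩
  have e1 := h1 x
  have e2 := h2 y
  rw [← hermForm_add_eq_hermPoly hA] at e1
  rw [← hermForm_add_eq_hermPoly hB.neg, hermForm_neg_left] at e2
  linarith

end Robust

/-! ### Matrix inequalities equivalent to the robust constraint -/

namespace CovertSystem

variable {M N : ℕ} (S : CovertSystem M N) (x₂ : ℝ) (W : Matrix (Fin M) (Fin M) ℂ)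
  (Q : Matrix (Fin N) (Fin N) ℂ)

theorem isHermitian_Qt {Q : Matrix (Fin N) (Fin N) ℂ} (hQ : Q.IsHermitian) :
    (Qt x₂ Q).IsHermitian := isHermitian_smul_real hQ _

theorem cornerMatrix_eq_borderMatrix (μ₁ c : ℝ) : S.cornerMatrix x₂ Q μ₁ c =
    borderMatrix (μ₁ • S.Crw + Qt x₂ Q) ((Qt x₂ Q)ᴴ *ᵥ S.hrw) c := by
  rw [cornerMatrix, borderMatrix, star_mulVec, conjTranspose_conjTranspose]

/-- The indices of the linear matrix inequality, with the scalar entry moved to the end. -/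
def lmiIndexEquiv (M N : ℕ) : (Fin N ⊕ Unit) ⊕ Fin M ≃ (Fin N ⊕ Fin M) ⊕ Unit :=
  ((Equiv.sumAssoc _ _ _).trans ((Equiv.refl _).sumCongr (Equiv.sumComm _ _))).trans
    (Equiv.sumAssoc _ _ _).symm

/-- Once the scalar entry comes last, the matrix is a block-diagonal one with a border, so it
homogenizes a polynomial in the pair of errors with no mixed term. -/
theorem lmiMatrix_eq_submatrix {W : Matrix (Fin M) (Fin M) ℂ} (hW : W.IsHermitian)
    (μ₁ μ₂ : ℝ) : S.lmiMatrix x₂ W Q μ₁ μ₂ =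
    (borderMatrix (fromBlocks (μ₁ • S.Crw + Qt x₂ Q) 0 0
        ((μ₂ / (S.κaw * S.oaw ^ 2)) • S.Caw - W))
      (Sum.elim ((Qt x₂ Q)ᴴ *ᵥ S.hrw) (-(W *ᵥ S.haw)))
      (S.q2 x₂ Q μ₁ - quadForm W S.haw - μ₂)).submatrix
        (lmiIndexEquiv M N) (lmiIndexEquiv M N) := by
  have hs : star (W *ᵥ S.haw) = star S.haw ᵥ* W := by rw [star_mulVec, hW.eq]
  have hq : star ((Qt x₂ Q)ᴴ *ᵥ S.hrw) = star S.hrw ᵥ* Qt x₂ Q := by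
    rw [star_mulVec, conjTranspose_conjTranspose]
  have hs' (i) : star ((W *ᵥ S.haw) i) = (star S.haw ᵥ* W) i := congrFun hs i
  have hq' (i) : star (((Qt x₂ Q)ᴴ *ᵥ S.hrw) i) = (star S.hrw ᵥ* Qt x₂ Q) i := congrFun hq i
  ext ((i | i) | i) ((j | j) | j) <;>
    simp [lmiMatrix, cornerMatrix, borderMatrix, lmiIndexEquiv, ← hs', ← hq']

theorem isHermitian_lmiMatrix (hS : S.Admissible) {W : Matrix (Fin M) (Fin M) ℂ}
    (hW : W.IsHermitian) {Q : Matrix (Fin N) (Fin N) ℂ} (hQ : Q.IsHermitian) (μ₁ μ₂ : ℝ) :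
    (S.lmiMatrix x₂ W Q μ₁ μ₂).IsHermitian := by
  rw [lmiMatrix_eq_submatrix S x₂ Q hW]
  refine (isHermitian_borderMatrix (IsHermitian.fromBlocks ?_ (by simp) ?_) _ _).submatrix _
  · exact (isHermitian_smul_real hS.Crw_psd.1 _).add (isHermitian_Qt x₂ hQ)
  · exact (isHermitian_smul_real hS.Caw_psd.1 _).sub hW

/-- The matrix encodes the Lagrangian of the constraint in the radar error, the other error being
held fixed; `q2` collects its constant terms except for the transmit power. -/
theorem posSemidef_qmiMatrix_iff (hS : S.Admissible) {Q : Matrix (Fin N) (Fin N) ℂ}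
    (hQ : Q.IsHermitian) (μ₁ : ℝ) (y : Fin M → ℂ) :
    (S.qmiMatrix x₂ W Q μ₁ y).PosSemidef ↔
      ∀ x, 0 ≤ hermForm (Qt x₂ Q) (S.hrw + x) + S.q1 x₂ - hermForm W (S.haw + y) -
        μ₁ * (S.κrw * S.orw ^ 2 - hermForm S.Crw x) := by
  have hQt := isHermitian_Qt x₂ hQ
  rw [qmiMatrix, cornerMatrix_eq_borderMatrix, posSemidef_borderMatrix_iff
    ((isHermitian_smul_real hS.Crw_psd.1 _).add hQt)]
  refine forall_congr' fun x => ?_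
  rw [hermPoly, hermForm_add_left, hermForm_smul_left, hQt.eq, star_mulVec_dotProduct hQt,
    hermForm_add hQt, q2]
  simp only [quadForm_eq_hermForm]
  refine iff_of_eq (congrArg _ ?_)
  ring

/-- The matrix encodes the Lagrangian in both errors. The variable `μ₂` is the constant term of its
penalty, so the actual multiplier is `μ₂` divided by the squared radius. -/
theorem posSemidef_lmiMatrix_iff (hS : S.Admissible) {W : Matrix (Fin M) (Fin M) ℂ}
    (hW : W.IsHermitian) {Q : Matrix (Fin N) (Fin N) ℂ} (hQ : Q.IsHermitian) (μ₁ μ₂ : ℝ) :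
    (S.lmiMatrix x₂ W Q μ₁ μ₂).PosSemidef ↔
      ∀ x y, 0 ≤ hermForm (Qt x₂ Q) (S.hrw + x) + S.q1 x₂ - hermForm W (S.haw + y) -
        μ₁ * (S.κrw * S.orw ^ 2 - hermForm S.Crw x) -
        μ₂ / (S.κaw * S.oaw ^ 2) * (S.κaw * S.oaw ^ 2 - hermForm S.Caw y) := by
  have hQt := isHermitian_Qt x₂ hQ
  have hs : S.κaw * S.oaw ^ 2 ≠ 0 := by
    have := hS.κaw_pos; have := hS.oaw_pos; positivity
  rw [lmiMatrix_eq_submatrix S x₂ Q hW, posSemidef_submatrix_equiv, posSemidef_borderMatrix_iff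
    (IsHermitian.fromBlocks ((isHermitian_smul_real hS.Crw_psd.1 _).add hQt) (by simp)
      ((isHermitian_smul_real hS.Caw_psd.1 _).sub hW))]
  have key : ∀ x y, hermPoly (fromBlocks (μ₁ • S.Crw + Qt x₂ Q) 0 0
        ((μ₂ / (S.κaw * S.oaw ^ 2)) • S.Caw - W))
      (Sum.elim ((Qt x₂ Q)ᴴ *ᵥ S.hrw) (-(W *ᵥ S.haw)))
      (S.q2 x₂ Q μ₁ - quadForm W S.haw - μ₂) (Sum.elim x y) =
      hermForm (Qt x₂ Q) (S.hrw + x) + S.q1 x₂ - hermForm W (S.haw + y) -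
        μ₁ * (S.κrw * S.orw ^ 2 - hermForm S.Crw x) -
        μ₂ / (S.κaw * S.oaw ^ 2) * (S.κaw * S.oaw ^ 2 - hermForm S.Caw y) := fun x y => by
    have h1 : star (Sum.elim ((Qt x₂ Q)ᴴ *ᵥ S.hrw) (-(W *ᵥ S.haw))) =
        Sum.elim (star ((Qt x₂ Q)ᴴ *ᵥ S.hrw)) (-star (W *ᵥ S.haw)) := by
      ext (i | i) <;> simp
    rw [hermPoly, hermForm_fromBlocks_diagonal, hermForm_add_left, hermForm_smul_left,
      hermForm_sub_left, hermForm_smul_left, h1, sumElim_dotProduct_sumElim, neg_dotProduct,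
      hQt.eq, star_mulVec_dotProduct hQt, star_mulVec_dotProduct hW, hermForm_add hQt,
      hermForm_add hW, q2, mul_sub (μ₂ / _), div_mul_cancel₀ _ hs]
    simp only [quadForm_eq_hermForm, Complex.add_re, Complex.neg_re]
    ring
  constructor
  · intro h x y
    rw [← key]; exact h _
  · intro h z
    rw [← Sum.elim_comp_inl_inr z, key]; exact h _ _

theorem mem_ellipsoid_iff {k : ℕ} (C : Matrix (Fin k) (Fin k) ℂ) {κ : ℝ} (hκ : 0 < κ) (o : ℝ)
    (x : Fin k → ℂ) : x ∈ ellipsoid C κ o ↔ hermForm C x ≤ κ * o ^ 2 := by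
  rw [ellipsoid, Set.mem_ofPred_eq, div_le_iff₀ hκ, mul_comm, quadForm_eq_hermForm]

theorem ratioConstraint_iff_quadConstraint (hS : S.Admissible) {Q : Matrix (Fin N) (Fin N) ℂ}
    (hQ : Q.PosSemidef) (y : Fin M → ℂ) (x : Fin N → ℂ) :
    S.RatioConstraint x₂ W Q y x ↔ S.QuadConstraint x₂ W Q y x := by
  have h0 : 0 ≤ hermForm Q (S.hrw + x) := (posSemidef_iff_hermForm.1 hQ).2 _
  have hσ := hS.σw_pos
  have hpos : 0 < hermForm Q (S.hrw + x) + S.σw ^ 2 := by positivity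
  rw [RatioConstraint, QuadConstraint, Qt, q1]
  simp only [quadForm_eq_hermForm]
  rw [hermForm_smul_left, div_le_iff₀ hpos]
  constructor <;> intro h <;> linarith

theorem quadConstraint_iff_worstCaseConstraint {Q : Matrix (Fin N) (Fin N) ℂ}
    (hQ : Q.IsHermitian) (y : Fin M → ℂ) (x : Fin N → ℂ) :
    S.QuadConstraint x₂ W Q y x ↔ S.WorstCaseConstraint x₂ W Q y x := by
  rw [QuadConstraint, WorstCaseConstraint]
  simp only [quadForm_eq_hermForm]
  rw [hermForm_add (isHermitian_Qt x₂ hQ)]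
  refine iff_of_eq (congrArg _ ?_)
  ring

theorem robustConstraint_tfae (hS : S.Admissible) {Q : Matrix (Fin N) (Fin N) ℂ}
    {W : Matrix (Fin M) (Fin M) ℂ} (hQ : Q.PosSemidef) (hW : W.PosSemidef) :
    List.TFAE [
      ∀ Δaw ∈ S.Eaw, ∀ Δrw ∈ S.Erw, S.RatioConstraint x₂ W Q Δaw Δrw,
      ∀ Δaw ∈ S.Eaw, ∀ Δrw ∈ S.Erw, S.QuadConstraint x₂ W Q Δaw Δrw,
      ∀ Δaw ∈ S.Eaw, ∀ Δrw ∈ S.Erw, S.WorstCaseConstraint x₂ W Q Δaw Δrw,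
      ∃ μ₁ : ℝ, 0 ≤ μ₁ ∧ ∀ Δaw ∈ S.Eaw, (S.qmiMatrix x₂ W Q μ₁ Δaw).PosSemidef,
      ∃ μ₁ μ₂ : ℝ, 0 ≤ μ₁ ∧ 0 ≤ μ₂ ∧ (S.lmiMatrix x₂ W Q μ₁ μ₂).PosSemidef] := by
  have hκa := hS.κaw_pos
  have hκr := hS.κrw_pos
  have hoa := hS.oaw_pos
  have hor := hS.orw_pos
  have hs : 0 < S.κaw * S.oaw ^ 2 := by positivity
  have hr : 0 < S.κrw * S.orw ^ 2 := by positivity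
  tfae_have 1 ↔ 2 := forall₄_congr fun y _ x _ =>
    S.ratioConstraint_iff_quadConstraint x₂ W hS hQ y x
  tfae_have 2 ↔ 3 := forall₄_congr fun y _ x _ =>
    S.quadConstraint_iff_worstCaseConstraint x₂ W hQ.1 y x
  tfae_have 2 → 5 := by
    intro h
    obtain ⟨μ, ν, hμ, hν, H⟩ := exists_multipliers (isHermitian_Qt x₂ hQ.1) hW.1 hS.Crw_psd.1
      hS.Caw_psd.1 S.hrw S.haw (S.q1 x₂) hr hs (fun y hy x hx => by
        have := h y ((mem_ellipsoid_iff _ hκa _ _).2 hy) x ((mem_ellipsoid_iff _ hκr _ _).2 hx)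
        rw [QuadConstraint] at this
        simp only [quadForm_eq_hermForm] at this
        linarith)
    -- The rescaling undoes the normalization of `μ₂` in the matrix.
    refine ⟨μ, ν * (S.κaw * S.oaw ^ 2), hμ, by positivity, ?_⟩
    rw [posSemidef_lmiMatrix_iff S x₂ hS hW.1 hQ.1, mul_div_cancel_right₀ _ hs.ne']
    exact H
  tfae_have 5 → 4 := by
    rintro ⟨μ, ν, hμ, hν, H⟩
    refine ⟨μ, hμ, fun y hy => ?_⟩
    rw [posSemidef_lmiMatrix_iff S x₂ hS hW.1 hQ.1] at H
    rw [posSemidef_qmiMatrix_iff S x₂ W hS hQ.1]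
    intro x
    have h1 := H x y
    have h2 := (mem_ellipsoid_iff _ hκa _ _).1 hy
    -- Inside the ellipsoid the penalty is nonnegative, so dropping it keeps the inequality.
    have h3 := mul_nonneg (div_nonneg hν hs.le) (sub_nonneg.2 h2)
    linarith
  tfae_have 4 → 2 := by
    rintro ⟨μ, hμ, H⟩ y hy x hx
    have h1 := (posSemidef_qmiMatrix_iff S x₂ W hS hQ.1 μ y).1 (H y hy) x
    have h2 := (mem_ellipsoid_iff _ hκr _ _).1 hx
    have h3 := mul_nonneg hμ (sub_nonneg.2 h2)
    rw [QuadConstraint]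
    simp only [quadForm_eq_hermForm]
    linarith
  tfae_finish

end CovertSystem

/-! ### Calculus of affine functions -/

section AffineFunctions

variable {V W W' : Type*} [AddCommGroup V] [Module ℝ V] [AddCommGroup W] [Module ℝ W]
  [AddCommGroup W'] [Module ℝ W']

/-- The function `f` underlies an affine map. -/
def IsAffineFun (f : V → W) : Prop := ∃ A : V →ᵃ[ℝ] W, ∀ x, f x = A x

namespace IsAffineFun

theorem const (w : W) : IsAffineFun fun _ : V => w := ⟨AffineMap.const ℝ V w, fun _ => rfl⟩

theorem of_isLinearMap {f : V → W} (hf : IsLinearMap ℝ f) : IsAffineFun f :=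
  ⟨(hf.mk' f).toAffineMap, fun _ => rfl⟩

theorem linear_comp {f : V → W} (hf : IsAffineFun f) (L : W →ₗ[ℝ] W') :
    IsAffineFun fun x => L (f x) := by
  obtain ⟨A, hA⟩ := hf
  exact ⟨L.toAffineMap.comp A, fun x => by simp [hA]⟩

theorem add {f g : V → W} (hf : IsAffineFun f) (hg : IsAffineFun g) :
    IsAffineFun fun x => f x + g x := by
  obtain ⟨A, hA⟩ := hf
  obtain ⟨B, hB⟩ := hg
  exact ⟨A + B, fun x => by simp [hA, hB]⟩

theorem neg {f : V → W} (hf : IsAffineFun f) : IsAffineFun fun x => -f x :=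
  hf.linear_comp (-LinearMap.id)

theorem sub {f g : V → W} (hf : IsAffineFun f) (hg : IsAffineFun g) :
    IsAffineFun fun x => f x - g x := by
  simpa only [sub_eq_add_neg] using hf.add hg.neg

theorem sum {ι : Type*} (s : Finset ι) {f : ι → V → W} (hf : ∀ i ∈ s, IsAffineFun (f i)) :
    IsAffineFun fun x => ∑ i ∈ s, f i x := by
  classical
  induction s using Finset.induction_on with
  | empty => simpa using const 0
  | insert a s ha ih =>
    simp only [Finset.sum_insert ha]
    exact (hf a (by simp)).add (ih fun i hi => hf i (by simp [hi]))

theorem matrix {n m : Type*} {f : V → Matrix n m ℂ} (hf : ∀ i j, IsAffineFun fun x => f x i j) :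
    IsAffineFun f := by
  choose A hA using hf
  exact ⟨AffineMap.pi fun i => AffineMap.pi fun j => A i j, fun x => by
    ext i j; exact hA i j x⟩

theorem const_mul {R : Type*} [Ring R] [Algebra ℝ R] {f : V → R} (hf : IsAffineFun f) (c : R) :
    IsAffineFun fun x => c * f x := hf.linear_comp (LinearMap.mulLeft ℝ c)

theorem mul_const {R : Type*} [Ring R] [Algebra ℝ R] {f : V → R} (hf : IsAffineFun f) (c : R) :
    IsAffineFun fun x => f x * c := hf.linear_comp (LinearMap.mulRight ℝ c)

theorem re {f : V → ℂ} (hf : IsAffineFun f) : IsAffineFun fun x => (f x).re :=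
  hf.linear_comp Complex.reLm

theorem star {f : V → ℂ} (hf : IsAffineFun f) : IsAffineFun fun x => star (f x) :=
  hf.linear_comp Complex.conjAe.toLinearMap

theorem ofReal {f : V → ℝ} (hf : IsAffineFun f) : IsAffineFun fun x => (f x : ℂ) :=
  hf.linear_comp Complex.ofRealAm.toLinearMap

theorem dotProduct_const {n : Type*} [Fintype n] {f : V → n → ℂ}
    (hf : ∀ i, IsAffineFun fun x => f x i) (c : n → ℂ) : IsAffineFun fun x => f x ⬝ᵥ c :=
  sum _ fun i _ => (hf i).mul_const (c i)

theorem const_dotProduct {n : Type*} [Fintype n] {f : V → n → ℂ}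
    (hf : ∀ i, IsAffineFun fun x => f x i) (c : n → ℂ) : IsAffineFun fun x => c ⬝ᵥ f x :=
  sum _ fun i _ => (hf i).const_mul (c i)

theorem quadForm {k : ℕ} {f : V → Matrix (Fin k) (Fin k) ℂ}
    (hf : ∀ i j, IsAffineFun fun x => f x i j) (c : Fin k → ℂ) :
    IsAffineFun fun x => quadForm (f x) c :=
  (const_dotProduct (fun i => dotProduct_const (hf i) c) _).re

end IsAffineFun

end AffineFunctions

/-! ### Real positive semidefinite matrices viewed over the complex numbers -/

section RealMatrices

-- Complex to real, test on real vectors; real to complex, a factorization `Bᴴ * B` survives the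
-- embedding. This admits the real tracking blocks into the complex format of
-- `IsSemidefiniteProgram`.
open scoped MatrixOrder in
theorem posSemidef_map_ofReal_iff {n : Type*} [Fintype n] [DecidableEq n] {A : Matrix n n ℝ} :
    (A.map Complex.ofReal).PosSemidef ↔ A.PosSemidef := by
  constructor
  · intro h
    refine PosSemidef.of_dotProduct_mulVec_nonneg ?_ fun x => ?_
    · ext i j
      have := congrFun (congrFun h.1 i) j
      simpa using this
    · have := h.dotProduct_mulVec_nonneg (fun i => (x i : ℂ))
      have e : star (fun i => (x i : ℂ)) ⬝ᵥ A.map Complex.ofReal *ᵥ (fun i => (x i : ℂ)) =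
          ((star x ⬝ᵥ A *ᵥ x : ℝ) : ℂ) := by
        simp [dotProduct, mulVec]
      rwa [e, Complex.zero_le_real] at this
  · intro h
    obtain ⟨B, rfl⟩ := CStarAlgebra.nonneg_iff_eq_star_mul_self.1 h.nonneg
    have e : (Bᴴ * B).map Complex.ofReal = (B.map Complex.ofReal)ᴴ * B.map Complex.ofReal := by
      ext i j; simp [mul_apply]
    rw [star_eq_conjTranspose, e]
    exact posSemidef_conjTranspose_mul_self _

end RealMatrices

/-! ### Closure properties of sets cut out by linear matrix inequalities -/

section LinearMatrixInequalities

variable {V : Type} [AddCommGroup V] [Module ℝ V]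

/-- The set `F` is described by finitely many linear matrix inequalities. -/
def IsLMISet (F : Set V) : Prop :=
  ∃ (K : Type) (_ : Finite K) (n : K → ℕ) (A : ∀ k, V →ᵃ[ℝ] Matrix (Fin (n k)) (Fin (n k)) ℂ),
    (∀ k x, (A k x).IsHermitian) ∧ ∀ x, x ∈ F ↔ ∀ k, (A k x).PosSemidef

namespace IsLMISet

theorem inter {F G : Set V} (hF : IsLMISet F) (hG : IsLMISet G) : IsLMISet (F ∩ G) := by
  obtain ⟨K, hK, n, A, hA, hAF⟩ := hF
  obtain ⟨L, hL, m, B, hB, hBG⟩ := hG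
  refine ⟨K ⊕ L, inferInstance, Sum.elim n m, Sum.rec A B, ?_, fun x => ?_⟩
  · rintro (k | k) x
    · exact hA k x
    · exact hB k x
  · rw [Set.mem_inter_iff, hAF, hBG, Sum.forall]
    rfl

theorem iInter {ι : Type} [Finite ι] {F : ι → Set V} (hF : ∀ i, IsLMISet (F i)) :
    IsLMISet (⋂ i, F i) := by
  choose K hK n A hA hAF using hF
  refine ⟨Σ i, K i, inferInstance, fun k => n k.1 k.2, fun k => A k.1 k.2,
    fun k x => hA k.1 k.2 x, fun x => ?_⟩
  simp only [Set.mem_iInter, hAF, Sigma.forall]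

theorem posSemidef {ι : Type*} [Fintype ι] {f : V → Matrix ι ι ℂ}
    (hf : ∀ i j, IsAffineFun fun x => f x i j) (hH : ∀ x, (f x).IsHermitian) :
    IsLMISet {x | (f x).PosSemidef} := by
  let e := (Fintype.equivFin ι).symm
  obtain ⟨A, hA⟩ := IsAffineFun.matrix (f := fun x => (f x).submatrix e e)
    fun i j => hf (e i) (e j)
  refine ⟨Unit, inferInstance, fun _ => Fintype.card ι, fun _ => A, fun _ x => ?_, fun x => ?_⟩
  · rw [← hA]; exact (hH x).submatrix e
  · rw [forall_const, ← hA, posSemidef_submatrix_equiv]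
    rfl

theorem nonneg {f : V → ℝ} (hf : IsAffineFun f) : IsLMISet {x | 0 ≤ f x} := by
  have h := posSemidef (ι := Unit) (f := fun x => diagonal fun _ => (f x : ℂ))
    (fun i j => by simpa using hf.ofReal)
    (fun x => by ext i j; simp)
  simpa [posSemidef_diagonal_iff, Pi.le_def] using h

theorem posSemidef_real {ι : Type*} [Fintype ι] [DecidableEq ι] {f : V → Matrix ι ι ℝ}
    (hf : ∀ i j, IsAffineFun fun x => f x i j) (hH : ∀ x, (f x).IsHermitian) :
    IsLMISet {x | (f x).PosSemidef} := by
  have h := posSemidef (f := fun x => (f x).map Complex.ofReal) (fun i j => (hf i j).ofReal)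
    (fun x => by
      ext i j
      have := congrFun (congrFun (hH x) i) j
      simpa using this)
  simpa only [posSemidef_map_ofReal_iff] using h

end IsLMISet

end LinearMatrixInequalities

/-! ### The semidefinite program and its projection onto the Dinkelbach step -/

namespace CovertSystem

variable {M N : ℕ} (S : CovertSystem M N) (x₂ : ℝ)

theorem posDef_infoMatrix (hS : S.Admissible) {Q : Matrix (Fin N) (Fin N) ℂ}
    (hQ : Q.PosSemidef) : (S.infoMatrix Q).PosDef := by
  refine hS.Cpred_pd.inv.add_posSemidef (PosSemidef.smul ?_ ?_)
  · exact hS.precision_psd.conjTranspose_mul_mul_same S.G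
  · exact mul_nonneg hS.gain_nonneg ((posSemidef_iff_hermForm.1 hQ).2 _)

theorem isHermitian_infoMatrix (hS : S.Admissible) (Q : Matrix (Fin N) (Fin N) ℂ) :
    (S.infoMatrix Q).IsHermitian := by
  refine hS.Cpred_pd.inv.1.add ?_
  have h : (S.Gᵀ * S.precision * S.G).IsHermitian :=
    (hS.precision_psd.conjTranspose_mul_mul_same S.G).1
  rw [IsHermitian, conjTranspose_smul, star_trivial, h.eq]

theorem isHermitian_mseMatrix (hS : S.Admissible) (Q : Matrix (Fin N) (Fin N) ℂ) (i : Fin 6)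
    (t : ℝ) : (S.mseMatrix Q i t).IsHermitian := by
  refine IsHermitian.fromBlocks (S.isHermitian_infoMatrix hS Q) ?_ ?_ <;> ext <;> simp

/-- The information matrix is positive definite, so positivity reduces to its Schur complement, the
`1 × 1` matrix with entry `t - (S.infoMatrix Q)⁻¹ i i`. -/
theorem posSemidef_mseMatrix_iff (hS : S.Admissible) {Q : Matrix (Fin N) (Fin N) ℂ}
    (hQ : Q.PosSemidef) (i : Fin 6) (t : ℝ) :
    (S.mseMatrix Q i t).PosSemidef ↔ (S.infoMatrix Q)⁻¹ i i ≤ t := by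
  have hP := S.posDef_infoMatrix hS hQ
  have := hP.isUnit.invertible
  have e : replicateRow Unit (Pi.single i (1 : ℝ)) = (replicateCol Unit (Pi.single i (1 : ℝ)))ᴴ := by
    ext; simp
  rw [mseMatrix, e, hP.fromBlocks₁₁]
  have e' : (of fun _ _ => t) - (replicateCol Unit (Pi.single i (1 : ℝ)))ᴴ * (S.infoMatrix Q)⁻¹ *
      replicateCol Unit (Pi.single i (1 : ℝ)) = diagonal fun _ : Unit => t - (S.infoMatrix Q)⁻¹ i i := by
    ext a b
    rw [← e, Matrix.mul_assoc]
    simp [Matrix.mul_apply, Pi.single_apply]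
  rw [e', posSemidef_diagonal_iff]
  simp

section Affine

variable {V : Type*} [AddCommGroup V] [Module ℝ V] {fW : V → Matrix (Fin M) (Fin M) ℂ}
  {fQ : V → Matrix (Fin N) (Fin N) ℂ} {t μ₁ μ₂ : V → ℝ}

theorem isAffineFun_Qt (hQ : ∀ i j, IsAffineFun fun u => fQ u i j) (i j : Fin N) :
    IsAffineFun fun u => Qt x₂ (fQ u) i j :=
  (hQ i j).linear_comp ((x₂ - 1) • LinearMap.id)

theorem isAffineFun_trace_mul {k : ℕ} (A : Matrix (Fin k) (Fin k) ℂ)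
    {f : V → Matrix (Fin k) (Fin k) ℂ} (hf : ∀ i j, IsAffineFun fun u => f u i j) :
    IsAffineFun fun u => (trace (A * f u)).re :=
  .re (.sum _ fun i _ => .const_dotProduct (fun j => hf j i) _)

theorem isAffineFun_infoMatrix (hQ : ∀ i j, IsAffineFun fun u => fQ u i j) (i j : Fin 6) :
    IsAffineFun fun u => S.infoMatrix (fQ u) i j :=
  .add (.const _) (.mul_const (.const_mul (.quadForm hQ _) _) _)

theorem isAffineFun_mseMatrix (hQ : ∀ i j, IsAffineFun fun u => fQ u i j) (ht : IsAffineFun t)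
    (k : Fin 6) (i j : Fin 6 ⊕ Unit) : IsAffineFun fun u => S.mseMatrix (fQ u) k (t u) i j := by
  rcases i with i | i <;> rcases j with j | j
  · exact S.isAffineFun_infoMatrix hQ i j
  · exact .const _
  · exact .const _
  · exact ht

theorem isAffineFun_q2 (hQ : ∀ i j, IsAffineFun fun u => fQ u i j) (h₁ : IsAffineFun μ₁) :
    IsAffineFun fun u => S.q2 x₂ (fQ u) (μ₁ u) :=
  .sub (.add (.quadForm (isAffineFun_Qt x₂ hQ) _) (.const _)) (.mul_const h₁ _)

/-- No entry multiplies two decision variables: the channels, the shape matrices and `x₂` are fixed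
data. -/
theorem isAffineFun_lmiMatrix (hW : ∀ i j, IsAffineFun fun u => fW u i j)
    (hQ : ∀ i j, IsAffineFun fun u => fQ u i j) (h₁ : IsAffineFun μ₁) (h₂ : IsAffineFun μ₂)
    (i j : (Fin N ⊕ Unit) ⊕ Fin M) :
    IsAffineFun fun u => S.lmiMatrix x₂ (fW u) (fQ u) (μ₁ u) (μ₂ u) i j := by
  rcases i with (i | i) | i <;> rcases j with (j | j) | j
  · exact .add (.linear_comp h₁ (LinearMap.toSpanSingleton ℝ ℂ (S.Crw i j)))
      (isAffineFun_Qt x₂ hQ i j)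
  · exact .dotProduct_const (fun k => (isAffineFun_Qt x₂ hQ k i).star) _
  · exact .const _
  · exact .const_dotProduct (fun k => isAffineFun_Qt x₂ hQ k j) _
  · exact .ofReal (.sub (.sub (S.isAffineFun_q2 x₂ hQ h₁) (.quadForm hW _)) h₂)
  · exact .neg (.const_dotProduct (fun k => hW k j) _)
  · exact .const _
  · exact .neg (.dotProduct_const (fun k => hW i k) _)
  · exact .sub (.linear_comp (.mul_const h₂ _)
      (LinearMap.toSpanSingleton ℝ ℂ (S.Caw i j))) (hW i j)

end Affine

theorem isSemidefiniteProgram_sdp (hS : S.Admissible) (l : ℝ) :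
    IsSemidefiniteProgram (S.sdpFeasible x₂) (fun u => S.stepObjective l u.1) := by
  have hW (i j : Fin M) :
      IsAffineFun fun u : SDPVar M N => (u.1.1 : Matrix (Fin M) (Fin M) ℂ) i j :=
    .of_isLinearMap ⟨fun _ _ => rfl, fun _ _ => rfl⟩
  have hQ (i j : Fin N) :
      IsAffineFun fun u : SDPVar M N => (u.1.2 : Matrix (Fin N) (Fin N) ℂ) i j :=
    .of_isLinearMap ⟨fun _ _ => rfl, fun _ _ => rfl⟩
  have ht (i : Fin 6) : IsAffineFun fun u : SDPVar M N => u.2.1 i :=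
    .of_isLinearMap ⟨fun _ _ => rfl, fun _ _ => rfl⟩
  have h₁ : IsAffineFun fun u : SDPVar M N => u.2.2.1 :=
    .of_isLinearMap ⟨fun _ _ => rfl, fun _ _ => rfl⟩
  have h₂ : IsAffineFun fun u : SDPVar M N => u.2.2.2 :=
    .of_isLinearMap ⟨fun _ _ => rfl, fun _ _ => rfl⟩
  refine ⟨(isAffineFun_trace_mul _ hW).sub
    (((isAffineFun_trace_mul _ hQ).add (.const _)).const_mul l), ?_⟩
  -- The remaining half of `IsSemidefiniteProgram` is `IsLMISet` by definition.
  change IsLMISet (S.sdpFeasible x₂)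
  have trW : IsAffineFun fun u : SDPVar M N =>
      (trace (u.1.1 : Matrix (Fin M) (Fin M) ℂ)).re := by
    simpa only [one_mul] using isAffineFun_trace_mul 1 hW
  have trQ : IsAffineFun fun u : SDPVar M N =>
      (trace (u.1.2 : Matrix (Fin N) (Fin N) ℂ)).re := by
    simpa only [one_mul] using isAffineFun_trace_mul 1 hQ
  have cW := IsLMISet.posSemidef hW fun u => u.1.1.2
  have cQ := IsLMISet.posSemidef hQ fun u => u.1.2.2
  have ctW := IsLMISet.nonneg ((IsAffineFun.const S.PA).sub trW)
  have ctQ := IsLMISet.nonneg ((IsAffineFun.const S.PR).sub trQ)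
  have ct := IsLMISet.iInter fun i => (IsLMISet.nonneg (ht i)).inter
    (IsLMISet.posSemidef_real (S.isAffineFun_mseMatrix hQ (ht i) i)
      fun u => S.isHermitian_mseMatrix hS _ i _)
  have cM := IsLMISet.nonneg ((IsAffineFun.const S.MSEmax).sub
    (IsAffineFun.sum Finset.univ fun i _ => ht i))
  have cL := IsLMISet.posSemidef (S.isAffineFun_lmiMatrix x₂ hW hQ h₁ h₂)
    fun u => S.isHermitian_lmiMatrix x₂ hS u.1.1.2 u.1.2.2 _ _
  have h := (cW.inter (ctW.inter (cQ.inter ctQ))).inter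
    (ct.inter (cM.inter ((IsLMISet.nonneg h₁).inter ((IsLMISet.nonneg h₂).inter cL))))
  convert h using 1
  ext u
  simp only [sdpFeasible, PowerConstraints, Set.mem_inter_iff, Set.mem_iInter, Set.mem_ofPred_eq,
    sub_nonneg]

theorem mem_stepFeasible_iff (hS : S.Admissible) (v : StepVar M N) :
    v ∈ S.stepFeasible x₂ ↔ ∃ r, (v, r) ∈ S.sdpFeasible x₂ := by
  constructor
  · rintro ⟨hP, hM, hR⟩
    obtain ⟨μ₁, μ₂, h1, h2, h3⟩ := ((S.robustConstraint_tfae x₂ hS hP.2.2.1 hP.1).out 1 4).1 hR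
    -- The smallest admissible slacks are the diagonal entries of the posterior covariance, and
    -- their sum is its trace.
    refine ⟨(fun i => (S.infoMatrix (v.2 : Matrix (Fin N) (Fin N) ℂ))⁻¹ i i, μ₁, μ₂), hP,
      fun i => ⟨?_, ?_⟩, hM, h1, h2, h3⟩
    · exact (S.posDef_infoMatrix hS hP.2.2.1).inv.posSemidef.diag_nonneg
    · exact (S.posSemidef_mseMatrix_iff hS hP.2.2.1 i _).2 le_rfl
  · rintro ⟨⟨t, μ₁, μ₂⟩, hP, ht, hM, h1, h2, h3⟩
    refine ⟨hP, le_trans (Finset.sum_le_sum fun i _ => ?_) hM,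
      ((S.robustConstraint_tfae x₂ hS hP.2.2.1 hP.1).out 1 4).2 ?_⟩
    swap
    · exact ⟨μ₁, μ₂, h1, h2, h3⟩
    exact (S.posSemidef_mseMatrix_iff hS hP.2.2.1 i _).1 (ht i).2

/-- The objective factors through the projection of `mem_stepFeasible_iff`, so optimality passes
both ways. -/
theorem isMaximizer_step_iff (hS : S.Admissible) (l : ℝ) (v : StepVar M N) :
    IsMaximizer (S.stepFeasible x₂) (S.stepObjective l) v ↔
      ∃ r, IsMaximizer (S.sdpFeasible x₂) (fun u => S.stepObjective l u.1) (v, r) := by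
  constructor
  · rintro ⟨hv, hmax⟩
    obtain ⟨r, hr⟩ := (S.mem_stepFeasible_iff x₂ hS v).1 hv
    exact ⟨r, hr, fun u hu => hmax u.1 ((S.mem_stepFeasible_iff x₂ hS u.1).2 ⟨u.2, hu⟩)⟩
  · rintro ⟨r, hr, hmax⟩
    refine ⟨(S.mem_stepFeasible_iff x₂ hS v).2 ⟨r, hr⟩, fun y hy => ?_⟩
    obtain ⟨s, hs⟩ := (S.mem_stepFeasible_iff x₂ hS y).1 hy
    exact hmax (y, s) hs

theorem powerH0_pos (hS : S.Admissible) {Q : Matrix (Fin N) (Fin N) ℂ} (hQ : Q.PosSemidef)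
    (hrw : Fin N → ℂ) : 0 < powerH0 Q hrw S.σw :=
  add_pos_of_nonneg_of_pos ((posSemidef_iff_hermForm.1 hQ).2 _) (pow_pos hS.σw_pos 2)

theorem powerH0_le_powerH1 (Q : Matrix (Fin N) (Fin N) ℂ) (w : Fin M → ℂ) (hrw : Fin N → ℂ)
    (haw : Fin M → ℂ) (σ : ℝ) : powerH0 Q hrw σ ≤ powerH1 Q w hrw haw σ := by
  rw [powerH0, powerH1]
  linarith [sq_nonneg ‖star haw ⬝ᵥ w‖]

end CovertSystem

theorem mainTheorem2 (ε : ℝ) (hε : 0 < ε) :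
    ∃ x₁ x₂ : ℝ, 0 < x₁ ∧ x₁ < 1 ∧ 1 < x₂ ∧
      -- `x₁`, `x₂` are the roots of `f`, which first decreases and then increases
      (∀ x : ℝ, 0 < x → (covertFun ε x = 0 ↔ x = x₁ ∨ x = x₂)) ∧
      StrictAntiOn (covertFun ε) (Set.Ioc 0 1) ∧ StrictMonoOn (covertFun ε) (Set.Ici 1) ∧
      -- the covertness constraint in terms of the power ratio
      (∀ v₀ v₁ : ℝ, 0 < v₀ → 0 < v₁ →
        (InformationTheory.klDiv (complexGaussian v₀) (complexGaussian v₁)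
            ≤ ENNReal.ofReal (2 * ε ^ 2) ↔
          x₁ ≤ v₁ / v₀ ∧ v₁ / v₀ ≤ x₂)) ∧
      ∀ (M N : ℕ) (S : CovertSystem M N), S.Admissible →
        -- the lower bound on the ratio is automatic
        (∀ (Q : Matrix (Fin N) (Fin N) ℂ) (w : Fin M → ℂ) (hrw : Fin N → ℂ) (haw : Fin M → ℂ),
          Q.PosSemidef →
          0 < powerH0 Q hrw S.σw ∧ powerH0 Q hrw S.σw ≤ powerH1 Q w hrw haw S.σw ∧
          (IsCovert ε Q w hrw haw S.σw ↔
            powerH1 Q w hrw haw S.σw / powerH0 Q hrw S.σw ≤ x₂)) ∧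
        -- equivalent forms of the relaxed robust constraint
        (∀ (Q : Matrix (Fin N) (Fin N) ℂ) (W : Matrix (Fin M) (Fin M) ℂ),
          Q.PosSemidef → W.PosSemidef →
          List.TFAE [
            ∀ Δaw ∈ S.Eaw, ∀ Δrw ∈ S.Erw, S.RatioConstraint x₂ W Q Δaw Δrw,
            ∀ Δaw ∈ S.Eaw, ∀ Δrw ∈ S.Erw, S.QuadConstraint x₂ W Q Δaw Δrw,
            ∀ Δaw ∈ S.Eaw, ∀ Δrw ∈ S.Erw, S.WorstCaseConstraint x₂ W Q Δaw Δrw,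
            ∃ μ₁ : ℝ, 0 ≤ μ₁ ∧ ∀ Δaw ∈ S.Eaw, (S.qmiMatrix x₂ W Q μ₁ Δaw).PosSemidef,
            ∃ μ₁ μ₂ : ℝ, 0 ≤ μ₁ ∧ 0 ≤ μ₂ ∧ (S.lmiMatrix x₂ W Q μ₁ μ₂).PosSemidef]) ∧
        -- the robust covertness constraint itself, at `W = w wᴴ`
        (∀ (Q : Matrix (Fin N) (Fin N) ℂ) (w : Fin M → ℂ), Q.PosSemidef →
          ((∀ Δaw ∈ S.Eaw, ∀ Δrw ∈ S.Erw,
              IsCovert ε Q w (S.hrw + Δrw) (S.haw + Δaw) S.σw) ↔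
            ∃ μ₁ μ₂ : ℝ, 0 ≤ μ₁ ∧ 0 ≤ μ₂ ∧
              (S.lmiMatrix x₂ (Matrix.vecMulVec w (star w)) Q μ₁ μ₂).PosSemidef)) ∧
        -- each Dinkelbach step is a semidefinite program
        (∀ l : ℝ,
          IsSemidefiniteProgram (S.sdpFeasible x₂) (fun u => S.stepObjective l u.1) ∧
          (∀ v, v ∈ S.stepFeasible x₂ ↔ ∃ r, (v, r) ∈ S.sdpFeasible x₂) ∧
          (∀ v, IsMaximizer (S.stepFeasible x₂) (S.stepObjective l) v ↔
            ∃ r, IsMaximizer (S.sdpFeasible x₂) (fun u => S.stepObjective l u.1) (v, r))) := by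
  obtain ⟨x₁, x₂, h0, h1, h2, hx₁, hx₂⟩ := exists_covertFun_roots hε
  have hkl : ∀ v₀ v₁ : ℝ, 0 < v₀ → 0 < v₁ →
      (InformationTheory.klDiv (complexGaussian v₀) (complexGaussian v₁)
        ≤ ENNReal.ofReal (2 * ε ^ 2) ↔ x₁ ≤ v₁ / v₀ ∧ v₁ / v₀ ≤ x₂) := fun v₀ v₁ hv₀ hv₁ => by
    rw [klDiv_complexGaussian_le_iff hv₀ hv₁,
      covertFun_nonpos_iff h0 h1 h2 hx₁ hx₂ (div_pos hv₁ hv₀)]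
  refine ⟨x₁, x₂, h0, h1, h2, fun x hx => covertFun_eq_zero_iff h0 h1 h2 hx₁ hx₂ hx,
    strictAntiOn_covertFun ε, strictMonoOn_covertFun ε, hkl, fun M N S hS => ?_⟩
  have hcov : ∀ (Q : Matrix (Fin N) (Fin N) ℂ) (w : Fin M → ℂ) (hrw : Fin N → ℂ)
      (haw : Fin M → ℂ), Q.PosSemidef → (IsCovert ε Q w hrw haw S.σw ↔
        powerH1 Q w hrw haw S.σw / powerH0 Q hrw S.σw ≤ x₂) := fun Q w hrw haw hQ => by
    have hpos := S.powerH0_pos hS hQ hrw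
    have hle := CovertSystem.powerH0_le_powerH1 Q w hrw haw S.σw
    rw [IsCovert, hkl _ _ hpos (hpos.trans_le hle)]
    -- The ratio is at least `1`, which exceeds `x₁`.
    exact and_iff_right (h1.le.trans ((one_le_div hpos).2 hle))
  refine ⟨fun Q w hrw haw hQ => ⟨S.powerH0_pos hS hQ hrw,
      CovertSystem.powerH0_le_powerH1 Q w hrw haw S.σw, hcov Q w hrw haw hQ⟩,
    fun Q W hQ hW => S.robustConstraint_tfae x₂ hS hQ hW, fun Q w hQ => ?_,
    fun l => ⟨S.isSemidefiniteProgram_sdp x₂ hS l, S.mem_stepFeasible_iff x₂ hS,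
      S.isMaximizer_step_iff x₂ hS l⟩⟩
  -- At `w wᴴ` the quadratic form is `|hᴴ w|²`, so the ratio constraint coincides with covertness
  -- for each pair of errors.
  refine Iff.trans ?_
    ((S.robustConstraint_tfae x₂ hS hQ (posSemidef_vecMulVec_self_star w)).out 0 4)
  refine forall₄_congr fun y _ x _ => ?_
  rw [hcov Q w _ _ hQ, CovertSystem.RatioConstraint, quadForm_eq_hermForm (vecMulVec _ _),
    hermForm_vecMulVec, powerH1, powerH0]
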